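/- Let $G=(V,E)$ be a finite simple graph. For $A\subseteq V$ and $v\in V$ let $d_A(v)$ be the number of neighbours of $v$ in $A$. The problem Satisfactory Partition asks whether $V$ has a partition $(V_1,V_2)$ into two nonempty parts such that $d_{V_i}(v)\ge d_{V_{3-i}}(v)$ for $i\in\{1,2\}$ and every $v\in V_i$. Balanced Satisfactory Partition asks whether there is such a partition with, in addition, $|V_1|=|V_2|$. A $c$-expression is a rooted tree $T$ in which every leaf is marked $o_i$, every node with two children is marked $\cup$, and every node with one child is marked $\rho_{i,j}$ or $\eta_{i,j}$, where $i,j\in\{1,\dots,c\}$ and $i\ne j$. Each node represents a graph with vertex labels in $\{1,\dots,c\}$: $o_i$ a single vertex of label $i$; $\cup$ the disjoint union of the graphs of the two children; $\rho_{i,j}$ the graph of the child with every label $i$ replaced by $j$; $\eta_{i,j}$ the graph of the child with all edges between vertices of label $i$ and vertices of label $j$ added. $T$ is a $c$-expression of $G$ if the graph represented by its root is isomorphic to $G$, and it is irredundant if for each edge $\{u,v\}$ exactly one $\eta$-node of $T$ adds the edge between $u$ and $v$. **Theorem.** For each of the problems Satisfactory Partition and Balanced Satisfactory Partition there is an algorithm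 which, given an $n$-vertex graph $G$ and an irredundant $c$-expression $T$ of $G$ with $O(n)$ nodes, solves the problem for $G$ in $O(n^{8c})$ time. The algorithm does not depend on $c$; the constant in the time bound depends only on $c$ and on the constant in the bound on the number of nodes of $T$. (Time is counted in elementary steps of a random access machine with words of $O(\log n)$ bits, where the implied constant again depends only on $c$ and on the bound on the number of nodes.) -/

import Mathlib

/-! ### Satisfactory partitions -/

namespace SatisfactoryPartition

open Classical in
/-- `degIn G A v` is the number of neighbours of `v` in `A`, written `d_A(v)`. -/
noncomputable def degIn {V : Type*} (G : SimpleGraph V) (A : Finset V) (v : V) : ℕ :=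
  (A.filter fun u => G.Adj v u).card

/-- `(V₁, V₂)` is a partition of the vertex set into two nonempty parts such that each vertex has
at least as many neighbours in its own part as in the other part. -/
structure IsSatisfactory {V : Type*} [Fintype V] (G : SimpleGraph V) (V₁ V₂ : Finset V) :
    Prop where
  nonempty_left : V₁.Nonempty
  nonempty_right : V₂.Nonempty
  disjoint : Disjoint V₁ V₂
  cover : ∀ v, v ∈ V₁ ∨ v ∈ V₂
  left : ∀ v ∈ V₁, degIn G V₂ v ≤ degIn G V₁ v
  right : ∀ v ∈ V₂, degIn G V₁ v ≤ degIn G V₂ v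

/-- The question of the problem Satisfactory Partition. -/
def HasSatisfactoryPartition {V : Type*} [Fintype V] (G : SimpleGraph V) : Prop :=
  ∃ V₁ V₂ : Finset V, IsSatisfactory G V₁ V₂

/-- The question of the problem Balanced Satisfactory Partition. (The answer is negative if the
number of vertices is odd.) -/
def HasBalancedSatisfactoryPartition {V : Type*} [Fintype V] (G : SimpleGraph V) : Prop :=
  ∃ V₁ V₂ : Finset V, IsSatisfactory G V₁ V₂ ∧ V₁.card = V₂.card

end SatisfactoryPartition

/-! ### Clique-width expressions -/

/-- A `c`-expression: a rooted tree whose leaves introduce a vertex with a label, whose binary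
nodes are disjoint unions, and whose unary nodes either relabel (label `i` is replaced by `j`) or
join (all edges between `i`-vertices and `j`-vertices are added), where `i ≠ j`. -/
inductive CExpr (c : ℕ) : Type
  | leaf (i : Fin c) : CExpr c
  | union (S T : CExpr c) : CExpr c
  | relabel (i j : Fin c) (h : i ≠ j) (T : CExpr c) : CExpr c
  | join (i j : Fin c) (h : i ≠ j) (T : CExpr c) : CExpr c

namespace CExpr

variable {c : ℕ}

/-- The number of nodes of the tree. -/
def size : CExpr c → ℕ
  | leaf _ => 1
  | union S T => S.size + T.size + 1
  | relabel _ _ _ T => T.size + 1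
  | join _ _ _ T => T.size + 1

/-- The vertices of the represented graph: the leaves of the tree. -/
def Vert : CExpr c → Type
  | leaf _ => Unit
  | union S T => S.Vert ⊕ T.Vert
  | relabel _ _ _ T => T.Vert
  | join _ _ _ T => T.Vert

/-- The labels of the vertices in the represented labeled graph. -/
def label : (T : CExpr c) → T.Vert → Fin c
  | leaf i => fun _ => i
  | union S T => Sum.elim S.label T.label
  | relabel i j _ T => fun v => if T.label v = i then j else T.label v
  | join _ _ _ T => T.label

/-- The represented graph. -/
def graph : (T : CExpr c) → SimpleGraph T.Vert
  | leaf _ => ⊥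
  | union S T => S.graph ⊕g T.graph
  | relabel _ _ _ T => T.graph
  | join i j _ T => T.graph ⊔ SimpleGraph.fromRel fun u v => T.label u = i ∧ T.label v = j

/-- The number of join nodes of the tree that add the edge between `u` and `v`, that is, of those
join nodes with labels `i`, `j` for which, just below the node, one of `u` and `v` is an
`i`-vertex and the other one is a `j`-vertex. -/
def addCount : (T : CExpr c) → T.Vert → T.Vert → ℕ
  | leaf _ => fun _ _ => 0
  | union S T => fun u v =>
      Sum.elim (fun u' => Sum.elim (fun v' => S.addCount u' v') (fun _ => 0) v)
        (fun u' => Sum.elim (fun _ => 0) (fun v' => T.addCount u' v') v) u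
  | relabel _ _ _ T => T.addCount
  | join i j _ T => fun u v => T.addCount u v +
      if (T.label u = i ∧ T.label v = j) ∨ (T.label u = j ∧ T.label v = i) then 1 else 0

/-- Each edge of the represented graph is added by exactly one join node. -/
def Irredundant (T : CExpr c) : Prop :=
  ∀ u v : T.Vert, T.graph.Adj u v → T.addCount u v = 1

/-- `T` is a `c`-expression of `G`: the graph represented by `T` is isomorphic to `G`. -/
def Represents {V : Type*} (T : CExpr c) (G : SimpleGraph V) : Prop :=
  Nonempty (T.graph ≃g G)

/-- The tree as a list of numbers: the nodes in postorder (children before their parent), with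
three numbers for each node, namely its kind and its labels. -/
def code : CExpr c → List ℕ
  | leaf i => [0, (i : ℕ), 0]
  | union S T => S.code ++ T.code ++ [1, 0, 0]
  | relabel i j _ T => T.code ++ [2, (i : ℕ), (j : ℕ)]
  | join i j _ T => T.code ++ [3, (i : ℕ), (j : ℕ)]

end CExpr

/-! ### A random access machine with bounded words

Programs have finitely many registers and a memory with indirect addressing. Every number that
occurs in a computation must fit into a word of `w` bits, otherwise the computation is stuck.
Each arithmetic operation, comparison, register or memory access, and each test or write, costs
one step. Programs are finite and do not depend on `w`. -/

namespace RAM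

structure State where
  reg : ℕ → ℕ
  mem : ℕ → ℕ

inductive BinOp
  | add
  | sub
  | mul
  | div
  | mod
  | lt
  | eq

/-- Arithmetic on natural numbers (with truncated subtraction); comparisons yield 1 or 0. -/
def BinOp.apply : BinOp → ℕ → ℕ → ℕ
  | add, a, b => a + b
  | sub, a, b => a - b
  | mul, a, b => a * b
  | div, a, b => a / b
  | mod, a, b => a % b
  | lt, a, b => if a < b then 1 else 0
  | eq, a, b => if a = b then 1 else 0

inductive Expr
  /-- A constant of the program. -/
  | const (k : ℕ)
  /-- The contents of register `x`. -/
  | reg (x : ℕ)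
  /-- The contents of the memory cell whose address is the value of `e`. -/
  | mem (e : Expr)
  | op (o : BinOp) (e f : Expr)

/-- The number of elementary operations in the evaluation of an expression. -/
def Expr.cost : Expr → ℕ
  | const _ => 1
  | reg _ => 1
  | mem e => e.cost + 1
  | op _ e f => e.cost + f.cost + 1

def Expr.eval (s : State) : Expr → ℕ
  | const k => k
  | reg x => s.reg x
  | mem e => s.mem (e.eval s)
  | op o e f => o.apply (e.eval s) (f.eval s)

/-- All numbers in the evaluation of the expression fit into words of `w` bits. -/
def Expr.Fits (w : ℕ) (s : State) : Expr → Prop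
  | const k => k < 2 ^ w
  | reg x => s.reg x < 2 ^ w
  | mem e => e.Fits w s ∧ s.mem (e.eval s) < 2 ^ w
  | op o e f => e.Fits w s ∧ f.Fits w s ∧ o.apply (e.eval s) (f.eval s) < 2 ^ w

inductive Cmd
  | skip
  /-- Write the value of `e` into register `x`. -/
  | assign (x : ℕ) (e : Expr)
  /-- Write the value of `e` into the memory cell whose address is the value of `a`. -/
  | store (a e : Expr)
  | seq (p q : Cmd)
  /-- Execute `p` if the value of `e` is not zero, and `q` otherwise. -/
  | ite (e : Expr) (p q : Cmd)
  /-- Repeat `p` as long as the value of `e` is not zero. -/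
  | loop (e : Expr) (p : Cmd)

/-- `Exec w p s t s'`: on a machine with words of `w` bits, the program `p`, started in state `s`,
halts after exactly `t` steps in state `s'`. -/
inductive Exec (w : ℕ) : Cmd → State → ℕ → State → Prop
  | skip (s : State) : Exec w .skip s 1 s
  | assign (s : State) (x : ℕ) (e : Expr) (he : e.Fits w s) :
      Exec w (.assign x e) s (e.cost + 1) ⟨Function.update s.reg x (e.eval s), s.mem⟩
  | store (s : State) (a e : Expr) (ha : a.Fits w s) (he : e.Fits w s) :
      Exec w (.store a e) s (a.cost + e.cost + 1)
        ⟨s.reg, Function.update s.mem (a.eval s) (e.eval s)⟩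
  | seq {p q : Cmd} {s s' s'' : State} {t t' : ℕ} (hp : Exec w p s t s')
      (hq : Exec w q s' t' s'') : Exec w (.seq p q) s (t + t') s''
  | ite_true {e : Expr} {p q : Cmd} {s s' : State} {t : ℕ} (he : e.Fits w s)
      (h : e.eval s ≠ 0) (hp : Exec w p s t s') : Exec w (.ite e p q) s (e.cost + 1 + t) s'
  | ite_false {e : Expr} {p q : Cmd} {s s' : State} {t : ℕ} (he : e.Fits w s)
      (h : e.eval s = 0) (hq : Exec w q s t s') : Exec w (.ite e p q) s (e.cost + 1 + t) s'
  | loop_stop {e : Expr} {p : Cmd} {s : State} (he : e.Fits w s) (h : e.eval s = 0) :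
      Exec w (.loop e p) s (e.cost + 1) s
  | loop_step {e : Expr} {p : Cmd} {s s' s'' : State} {t t' : ℕ} (he : e.Fits w s)
      (h : e.eval s ≠ 0) (hp : Exec w p s t s') (hl : Exec w (.loop e p) s' t' s'') :
      Exec w (.loop e p) s (e.cost + 1 + t + t') s''

/-- At the start the input is in the memory cells 0, 1, 2, …; everything else is zero. -/
def initial (input : List ℕ) : State := ⟨fun _ => 0, fun a => input.getD a 0⟩

/-- On a machine with words of `w` bits, the program `p` halts on the given input after at most
`t` steps with the answer to the question `Q` (1 for yes, 0 for no) in register 0. -/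
def Decides (w : ℕ) (p : Cmd) (input : List ℕ) (t : ℕ) (Q : Prop) : Prop :=
  ∃ t' s', t' ≤ t ∧ Exec w p (initial input) t' s' ∧
    (Q → s'.reg 0 = 1) ∧ (¬ Q → s'.reg 0 = 0)

end RAM

/-! ### The decision problems with a given expression -/

namespace SatisfactoryPartition

open Classical in
/-- The adjacency matrix of `G`, row by row. -/
noncomputable def graphCode {n : ℕ} (G : SimpleGraph (Fin n)) : List ℕ :=
  (List.finRange n).flatMap fun u => (List.finRange n).map fun v => if G.Adj u v then 1 else 0

/-- The input that consists of a graph `G` and a `c`-expression `T`: the numbers `n`, `c` and the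
number of nodes of `T`, then `T`, then the adjacency matrix of `G`. -/
noncomputable def inputCode {n c : ℕ} (G : SimpleGraph (Fin n)) (T : CExpr c) : List ℕ :=
  [n, c, T.size] ++ T.code ++ graphCode G

end SatisfactoryPartition

/-! The algorithm is dynamic programming over the subtrees of the expression. A partition is a
Boolean function `U`, and stability at a vertex depends only on its `excess`, the neighbours in one
part minus those in the other. A join treats all vertices of a label alike. So a subtree needs one
integer per label from the rest of the tree, the excess `x l` that vertices of label `l` receive
from edges added later. Conversely, the rest needs from the subtree only its `profile`, the number
of vertices of each label in each part. The table therefore records `Feasible`: is there a partition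
with profile `γ` that is stable once `x` is added?

Each entry follows from entries of the children. A union splits the profile and passes `x` to both
children. A relabelling moves digits of the profile and gives label `i` the later excess of `j`. A
join keeps the profile and shifts `x` by differences of digits of `γ`. This shift is exact because
of irredundancy: no edge between the two label classes exists before the join
(`Irredundant.not_adj`, `excess_join`). `feasible_iff_hit` brings all kinds of node into one form, a
search over one profile of a child. At the root `x = 0`, and the profile alone tells whether both
parts are nonempty or of equal size.

Let `m` be the number of nodes. Profiles are numbers with `2c` digits in base `n + 1`. From the zero
vector at the root, each join changes an entry of `x` by at most `n`, so the vectors that matter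
(`Valid`) have entries between `-nm` and `nm` and are numbers with `c` digits in base `2nm + 1`. One
flat loop over pairs of an entry and a child profile fills the table, with children first by
postorder. For `m = O(n)` it has `O(n ^ (6c + 1))` rounds, which is within `n ^ (8c)` since `c ≥ 1`.
Vectors that are not `Valid` may produce meaningless entries; the invariant `HasTable` makes no
claim about them.

On the machine side, all stored numbers stay below the polynomial `wordBound`. A fixed program
without loops takes boundedly many steps and raises numbers below `Y` at most to a fixed power of
`Y`, so words of `O(log n)` bits suffice. -/

namespace RAM

/-! ### Reasoning about running time and word size -/

/-- All registers and memory cells hold numbers below `Y`. -/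
def State.Below (Y : ℕ) (s : State) : Prop := (∀ x, s.reg x < Y) ∧ ∀ a, s.mem a < Y

/-- An upper bound for the cost of an expression and for the exponent in the growth of its
value. -/
def Expr.weight : Expr → ℕ
  | const k => k + 1
  | reg _ => 1
  | mem e => e.weight + 1
  | op _ e f => e.weight + f.weight + 1

/-- For a loop this accounts for one guard test and one round. Parts of a program never weigh more
than the whole, so a single hypothesis `Y ^ weight ≤ 2 ^ w` serves all of them. -/
def Cmd.weight : Cmd → ℕ
  | skip => 1
  | assign _ e => e.weight + 1
  | store a e => a.weight + e.weight + 1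
  | seq p q => p.weight + q.weight
  | ite e p q => e.weight + 1 + p.weight + q.weight
  | loop e p => e.weight + 1 + p.weight

theorem Expr.cost_le_weight (e : Expr) : e.cost ≤ e.weight := by
  induction e with
  | const k => simp [cost, weight]
  | reg x => simp [cost, weight]
  | mem e ih => simp [cost, weight, ih]
  | op o e f ihe ihf => simp only [cost, weight]; omega

/-- Sums and products stay below `2 * Y ^ u * Y ^ v`, and the extra 1 in the exponent pays for the
factor 2. The same room covers the value 1 of a comparison. -/
theorem BinOp.apply_lt_pow {Y a b u v : ℕ} (hY : 2 ≤ Y) (o : BinOp) (ha : a < Y ^ u)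
    (hb : b < Y ^ v) : o.apply a b < Y ^ (u + v + 1) := by
  have hu : 1 ≤ Y ^ u := Nat.one_le_pow _ _ (by omega)
  have hv : 1 ≤ Y ^ v := Nat.one_le_pow _ _ (by omega)
  have hmul : Y ^ u * Y ^ v * 2 ≤ Y ^ (u + v + 1) := by
    rw [pow_succ, pow_add]
    exact Nat.mul_le_mul_left _ hY
  have h1 : Y ^ u ≤ Y ^ u * Y ^ v := Nat.le_mul_of_pos_right _ hv
  have h2 : Y ^ v ≤ Y ^ u * Y ^ v := Nat.le_mul_of_pos_left _ hu
  have h3 : a * b ≤ Y ^ u * Y ^ v := Nat.mul_le_mul ha.le hb.le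
  have h4 : a / b ≤ a := Nat.div_le_self a b
  have h5 : a % b ≤ a := Nat.mod_le a b
  cases o <;> simp only [BinOp.apply] <;> first | omega | (split_ifs <;> omega)

theorem Expr.eval_lt_pow {Y : ℕ} (hY : 2 ≤ Y) {s : State} (hs : s.Below Y) (e : Expr) :
    e.eval s < Y ^ e.weight := by
  induction e with
  | const k =>
    calc k < k + 1 := by omega
      _ < 2 ^ (k + 1) := Nat.lt_two_pow_self
      _ ≤ Y ^ (k + 1) := Nat.pow_le_pow_left hY _
  | reg x => simpa [weight, eval] using hs.1 x
  | mem e ih =>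
    exact (hs.2 _).trans_le (Nat.le_self_pow (by simp [weight]) _)
  | op o e f ihe ihf => exact o.apply_lt_pow hY ihe ihf

theorem Expr.fits_of_below {Y w : ℕ} (hY : 2 ≤ Y) {s : State} (hs : s.Below Y) (e : Expr)
    (hw : Y ^ e.weight ≤ 2 ^ w) : e.Fits w s := by
  have mono : ∀ {a b : ℕ}, a ≤ b → Y ^ a ≤ Y ^ b := fun h => Nat.pow_le_pow_right (by omega) h
  induction e with
  | const k => exact (eval_lt_pow hY hs (const k)).trans_le hw
  | reg x => exact (eval_lt_pow hY hs (reg x)).trans_le hw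
  | mem e ih =>
    exact ⟨ih ((mono (by simp [weight])).trans hw), (eval_lt_pow hY hs (mem e)).trans_le hw⟩
  | op o e f ihe ihf =>
    exact ⟨ihe ((mono (by simp only [weight]; omega)).trans hw),
      ihf ((mono (by simp only [weight]; omega)).trans hw),
      (eval_lt_pow hY hs (op o e f)).trans_le hw⟩

/-- The program `p` halts after at most `t` steps in a state that satisfies `P`. -/
def Run (w : ℕ) (p : Cmd) (s : State) (t : ℕ) (P : State → Prop) : Prop :=
  ∃ t' s', t' ≤ t ∧ Exec w p s t' s' ∧ P s'

theorem Run.mono {w : ℕ} {p : Cmd} {s : State} {t u : ℕ} {P Q : State → Prop}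
    (h : Run w p s t P) (htu : t ≤ u) (hPQ : ∀ s', P s' → Q s') : Run w p s u Q := by
  obtain ⟨t', s', h1, h2, h3⟩ := h
  exact ⟨t', s', h1.trans htu, h2, hPQ _ h3⟩

theorem Run.seq {w : ℕ} {p q : Cmd} {s : State} {t u : ℕ} {P Q : State → Prop}
    (hp : Run w p s t P) (hq : ∀ s', P s' → Run w q s' u Q) :
    Run w (.seq p q) s (t + u) Q := by
  obtain ⟨t', s', h1, h2, h3⟩ := hp
  obtain ⟨u', s'', h4, h5, h6⟩ := hq s' h3
  exact ⟨_, s'', Nat.add_le_add h1 h4, .seq h2 h5, h6⟩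

theorem Run.assign {Y w : ℕ} (hY : 2 ≤ Y) {s : State} (hs : s.Below Y) {x : ℕ} {e : Expr}
    (hw : Y ^ (Cmd.assign x e).weight ≤ 2 ^ w) (he : e.eval s < Y) :
    Run w (.assign x e) s (Cmd.assign x e).weight fun s' =>
      s'.Below Y ∧ s' = ⟨Function.update s.reg x (e.eval s), s.mem⟩ := by
  refine ⟨_, _, ?_, .assign s x e (e.fits_of_below hY hs
    ((Nat.pow_le_pow_right (by omega) (by simp [Cmd.weight])).trans hw)), ⟨?_, ?_⟩, rfl⟩
  · have := e.cost_le_weight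
    simp only [Cmd.weight]; omega
  · intro y
    by_cases h : y = x
    · subst h; simpa using he
    · simpa [h] using hs.1 y
  · exact hs.2

theorem Run.store {Y w : ℕ} (hY : 2 ≤ Y) {s : State} (hs : s.Below Y) {a e : Expr}
    (hw : Y ^ (Cmd.store a e).weight ≤ 2 ^ w) (he : e.eval s < Y) :
    Run w (.store a e) s (Cmd.store a e).weight fun s' =>
      s'.Below Y ∧ s' = ⟨s.reg, Function.update s.mem (a.eval s) (e.eval s)⟩ := by
  have hle : ∀ {k : ℕ}, k ≤ (Cmd.store a e).weight → Y ^ k ≤ 2 ^ w :=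
    fun h => (Nat.pow_le_pow_right (by omega) h).trans hw
  refine ⟨_, _, ?_, .store s a e (a.fits_of_below hY hs (hle ?_))
    (e.fits_of_below hY hs (hle ?_)), ⟨hs.1, ?_⟩, rfl⟩
  · have := e.cost_le_weight
    have := a.cost_le_weight
    simp only [Cmd.weight]; omega
  · simp only [Cmd.weight]; omega
  · simp only [Cmd.weight]; omega
  · intro y
    by_cases h : y = a.eval s
    · subst h; simpa using he
    · simpa [h] using hs.2 y

/-- A loop whose guard stays nonzero for exactly `N` rounds. -/
theorem Run.loop {Y w : ℕ} (hY : 2 ≤ Y) {e : Expr} {p : Cmd}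
    (hw : Y ^ (Cmd.loop e p).weight ≤ 2 ^ w) (I : ℕ → State → Prop) (N : ℕ)
    (hI : ∀ k s, I k s → s.Below Y) (hguard : ∀ s, I N s → e.eval s = 0)
    (hgo : ∀ k s, k < N → I k s → e.eval s ≠ 0)
    (hstep : ∀ k s, k < N → I k s → Run w p s p.weight (I (k + 1)))
    {s : State} (hs : I 0 s) :
    Run w (.loop e p) s ((N + 1) * (Cmd.loop e p).weight) (I N) := by
  have hfit : ∀ k s, I k s → e.Fits w s := fun k s h => e.fits_of_below hY (hI k s h)
    ((Nat.pow_le_pow_right (by omega) (by simp only [Cmd.weight]; omega)).trans hw)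
  have hcost := e.cost_le_weight
  -- Induction on the number `j` of remaining rounds; the additional 1 pays for the final test of
  -- the guard.
  have key : ∀ j k s, k + j = N → I k s →
      Run w (.loop e p) s ((j + 1) * (Cmd.loop e p).weight) (I N) := by
    intro j
    induction j with
    | zero =>
      intro k s hk h
      obtain rfl : k = N := by omega
      refine ⟨_, s, ?_, Exec.loop_stop (hfit _ _ h) (hguard _ h), h⟩
      simp only [Cmd.weight]; omega
    | succ j ih =>
      intro k s hk h
      obtain ⟨t1, s1, ht1, h1, hI1⟩ := hstep k s (by omega) h
      obtain ⟨t2, s2, ht2, h2, hI2⟩ := ih (k + 1) s1 (by omega) hI1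
      refine ⟨_, s2, ?_, .loop_step (hfit _ _ h) (hgo k s (by omega) h) h1 h2, hI2⟩
      rw [add_mul (j + 1) 1, one_mul]
      simp only [Cmd.weight] at *
      omega
  exact key N 0 s (by omega) hs

end RAM

/-! ### Positional notation -/

theorem sum_digits_lt_pow {B : ℕ} {f : ℕ → ℕ} (hf : ∀ j, f j < B) (N : ℕ) :
    ∑ j ∈ Finset.range N, f j * B ^ j < B ^ N := by
  induction N with
  | zero => simp
  | succ N ih =>
    rw [Finset.sum_range_succ, pow_succ]
    have h : (f N + 1) * B ^ N ≤ B * B ^ N := Nat.mul_le_mul_right _ (hf N)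
    linarith

/-- The digits below position `i` add up to less than `B ^ i`, so the division discards exactly
these. -/
theorem sum_digits_div_pow {B : ℕ} {f : ℕ → ℕ} (hf : ∀ j, f j < B) (i r : ℕ) :
    (∑ j ∈ Finset.range (i + r), f j * B ^ j) / B ^ i =
      ∑ j ∈ Finset.range r, f (i + j) * B ^ j := by
  have hB : 0 < B := (Nat.zero_le _).trans_lt (hf 0)
  rw [Finset.sum_range_add, show ∑ j ∈ Finset.range r, f (i + j) * B ^ (i + j) =
    B ^ i * ∑ j ∈ Finset.range r, f (i + j) * B ^ j by
      rw [Finset.mul_sum]; exact Finset.sum_congr rfl fun j _ => by ring,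
    Nat.add_mul_div_left _ _ (pow_pos hB i), Nat.div_eq_of_lt (sum_digits_lt_pow hf i), zero_add]

theorem sum_digits_mod_pow {B : ℕ} {f : ℕ → ℕ} (hf : ∀ j, f j < B) (i r : ℕ) :
    (∑ j ∈ Finset.range (i + r), f j * B ^ j) % B ^ i = ∑ j ∈ Finset.range i, f j * B ^ j := by
  rw [Finset.sum_range_add, show ∑ j ∈ Finset.range r, f (i + j) * B ^ (i + j) =
    B ^ i * ∑ j ∈ Finset.range r, f (i + j) * B ^ j by
      rw [Finset.mul_sum]; exact Finset.sum_congr rfl fun j _ => by ring,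
    Nat.add_mul_mod_self_left, Nat.mod_eq_of_lt (sum_digits_lt_pow hf i)]

theorem sum_digits_digit {B : ℕ} {f : ℕ → ℕ} (hf : ∀ j, f j < B) {i N : ℕ} (hi : i < N) :
    (∑ j ∈ Finset.range N, f j * B ^ j) / B ^ i % B = f i := by
  obtain ⟨r, rfl⟩ : ∃ r, N = i + (1 + r) := ⟨N - i - 1, by omega⟩
  have h := sum_digits_mod_pow (f := fun j => f (i + j)) (fun j => hf _) 1 r
  simp only [pow_one] at h
  rw [sum_digits_div_pow hf, h]
  simp

/-! ### Partitions as Boolean functions -/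

namespace SatisfactoryPartition

open Classical in
/-- The number of neighbours of `v` in the part `U = false` minus the number of neighbours in the
part `U = true`. -/
noncomputable def excess {V : Type*} [Fintype V] (G : SimpleGraph V) (U : V → Bool) (v : V) : ℤ :=
  ∑ u, if G.Adj v u then (if U u then -1 else 1) else 0

/-- With an additional excess `y v` at each vertex `v`, no vertex has a majority of neighbours in
the other part. -/
def Stable {V : Type*} [Fintype V] (G : SimpleGraph V) (U : V → Bool) (y : V → ℤ) : Prop :=
  ∀ v, (U v = true → excess G U v + y v ≤ 0) ∧ (U v = false → 0 ≤ excess G U v + y v)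

open Classical in
theorem excess_eq {V : Type*} [Fintype V] (G : SimpleGraph V) (U : V → Bool) (v : V) :
    excess G U v = (degIn G (Finset.univ.filter fun u => U u = false) v : ℤ) -
      degIn G (Finset.univ.filter fun u => U u = true) v := by
  simp only [excess, degIn, Finset.card_filter, Finset.sum_filter, Nat.cast_sum, Nat.cast_ite,
    Nat.cast_one, Nat.cast_zero]
  rw [← Finset.sum_sub_distrib]
  refine Finset.sum_congr rfl fun u _ => ?_
  cases U u <;> by_cases h : G.Adj v u <;> simp [h]

/-- Disjointness and covering make the second part the complement of the first, so the indicator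
function of the first part carries everything. -/
theorem isSatisfactory_iff {V : Type*} [Fintype V] [DecidableEq V] (G : SimpleGraph V)
    (V₁ V₂ : Finset V) :
    IsSatisfactory G V₁ V₂ ↔ ∃ U : V → Bool, (V₁ = Finset.univ.filter fun u => U u = true) ∧
      (V₂ = Finset.univ.filter fun u => U u = false) ∧ (∃ v, U v = true) ∧ (∃ v, U v = false) ∧
        Stable G U 0 := by
  classical
  constructor
  · intro h
    have h1 : V₁ = Finset.univ.filter fun u => decide (u ∈ V₁) = true := by ext; simp
    have h2 : V₂ = Finset.univ.filter fun u => decide (u ∈ V₁) = false := by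
      ext u
      have := h.cover u
      have hd := Finset.disjoint_left.1 h.disjoint
      have := @hd u
      simp; tauto
    refine ⟨fun u => decide (u ∈ V₁), h1, h2, ?_, ?_, fun v => ⟨fun hv => ?_, fun hv => ?_⟩⟩
    · obtain ⟨v, hv⟩ := h.nonempty_left
      exact ⟨v, by simpa using hv⟩
    · obtain ⟨v, hv⟩ := h.nonempty_right
      rw [h2] at hv
      exact ⟨v, by simpa using hv⟩
    · have := h.left v (by simpa using hv)
      rw [excess_eq, ← h1, ← h2]
      simpa using this
    · have := h.right v (by rw [h2]; simpa using hv)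
      rw [excess_eq, ← h1, ← h2]
      simpa using this
  · rintro ⟨U, rfl, rfl, ⟨a, ha⟩, ⟨b, hb⟩, hU⟩
    refine ⟨⟨a, by simpa using ha⟩, ⟨b, by simpa using hb⟩, ?_, ?_, ?_, ?_⟩
    · rw [Finset.disjoint_left]; intro v; simp
    · intro v; simp
    · intro v hv
      have := (hU v).1 (by simpa using hv)
      rw [excess_eq] at this
      simp at this
      convert this
    · intro v hv
      have := (hU v).2 (by simpa using hv)
      rw [excess_eq] at this
      simp at this
      convert this

theorem excess_bot {V : Type*} [Fintype V] (U : V → Bool) (v : V) :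
    excess (⊥ : SimpleGraph V) U v = 0 := by
  simp [excess]

theorem excess_sum_inl {V W : Type*} [Fintype V] [Fintype W] (G : SimpleGraph V)
    (H : SimpleGraph W) (U : V ⊕ W → Bool) (v : V) :
    excess (G ⊕g H) U (Sum.inl v) = excess G (fun v => U (Sum.inl v)) v := by
  have h0 : ∀ u, ¬ (G ⊕g H).Adj (Sum.inl v) (Sum.inr u) := by simp
  simp only [excess, Fintype.sum_sum_type, if_neg (h0 _), Finset.sum_const_zero, add_zero]
  exact Finset.sum_congr rfl fun u _ => by congr 1

theorem excess_sum_inr {V W : Type*} [Fintype V] [Fintype W] (G : SimpleGraph V)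
    (H : SimpleGraph W) (U : V ⊕ W → Bool) (w : W) :
    excess (G ⊕g H) U (Sum.inr w) = excess H (fun w => U (Sum.inr w)) w := by
  have h0 : ∀ u, ¬ (G ⊕g H).Adj (Sum.inr w) (Sum.inl u) := by simp
  simp only [excess, Fintype.sum_sum_type, if_neg (h0 _), Finset.sum_const_zero, zero_add]
  exact Finset.sum_congr rfl fun u _ => by congr 1

theorem excess_comp_iso {V W : Type*} [Fintype V] [Fintype W] {G : SimpleGraph V}
    {H : SimpleGraph W} (φ : G ≃g H) (U : W → Bool) (v : V) :
    excess G (U ∘ φ) v = excess H U (φ v) := by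
  classical
  unfold excess
  rw [← Equiv.sum_comp φ.toEquiv]
  refine Finset.sum_congr rfl fun u _ => ?_
  have : H.Adj (φ v) (φ.toEquiv u) ↔ G.Adj v u := φ.map_rel_iff
  simp only [this]
  rfl

theorem stable_comp_iso {V W : Type*} [Fintype V] [Fintype W] {G : SimpleGraph V}
    {H : SimpleGraph W} (φ : G ≃g H) (U : W → Bool) : Stable G (U ∘ φ) 0 ↔ Stable H U 0 := by
  constructor
  · intro h v
    obtain ⟨v, rfl⟩ := φ.surjective v
    simpa [excess_comp_iso] using h v
  · intro h v
    simpa [excess_comp_iso] using h (φ v)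

theorem hasSatisfactoryPartition_iff {V W : Type*} [Fintype V] [Fintype W] {G : SimpleGraph V}
    {H : SimpleGraph W} (φ : G ≃g H) :
    HasSatisfactoryPartition H ↔
      ∃ U : V → Bool, (∃ v, U v = true) ∧ (∃ v, U v = false) ∧ Stable G U 0 := by
  classical
  simp only [HasSatisfactoryPartition, isSatisfactory_iff]
  constructor
  · rintro ⟨_, _, U, -, -, ⟨a, ha⟩, ⟨b, hb⟩, hU⟩
    exact ⟨U ∘ φ, ⟨φ.symm a, by simpa using ha⟩, ⟨φ.symm b, by simpa using hb⟩,
      (stable_comp_iso φ U).2 hU⟩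
  · rintro ⟨U, ⟨a, ha⟩, ⟨b, hb⟩, hU⟩
    exact ⟨_, _, U ∘ φ.symm, rfl, rfl, ⟨φ a, by simpa using ha⟩, ⟨φ b, by simpa using hb⟩,
      (stable_comp_iso φ.symm U).2 hU⟩

/-- In a nonempty graph two parts of equal size are automatically nonempty, so only the size of one
part has to be controlled. -/
theorem hasBalancedSatisfactoryPartition_iff {V W : Type*} [Fintype V] [Fintype W] [Nonempty V]
    {G : SimpleGraph V} {H : SimpleGraph W} (φ : G ≃g H) :
    HasBalancedSatisfactoryPartition H ↔
      ∃ U : V → Bool, 2 * (Finset.univ.filter fun u => U u = true).card = Fintype.card V ∧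
        Stable G U 0 := by
  classical
  have hcard : ∀ U : V → Bool, (Finset.univ.filter fun u => U u = true).card +
      (Finset.univ.filter fun u => U u = false).card = Fintype.card V := by
    intro U
    simpa using Finset.card_filter_add_card_filter_not (s := Finset.univ) fun u => U u = true
  have hφ : ∀ (U : W → Bool) (b : Bool), (Finset.univ.filter fun u => (U ∘ φ) u = b).card =
      (Finset.univ.filter fun u => U u = b).card := fun U b =>
    Finset.card_equiv φ.toEquiv fun v => by simp
  simp only [HasBalancedSatisfactoryPartition, isSatisfactory_iff]
  constructor
  · rintro ⟨_, _, ⟨U, rfl, rfl, ⟨a, ha⟩, ⟨b, hb⟩, hU⟩, h⟩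
    refine ⟨U ∘ φ, ?_, (stable_comp_iso φ U).2 hU⟩
    rw [← hcard (U ∘ φ), hφ, hφ]; omega
  · rintro ⟨U, hc, hU⟩
    have h0 : 0 < Fintype.card V := Fintype.card_pos
    have h1 := hcard U
    have h2 := hφ (U ∘ φ.symm)
    simp only [Function.comp_assoc, RelIso.symm_comp_self, Function.comp_id] at h2
    have h3 : ∀ b, 0 < (Finset.univ.filter fun u => U u = b).card → ∃ v, (U ∘ φ.symm) v = b := by
      intro b hb
      obtain ⟨v, hv⟩ := Finset.card_pos.1 hb
      exact ⟨φ v, by simpa using hv⟩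
    refine ⟨_, _, ⟨U ∘ φ.symm, rfl, rfl, h3 _ (by omega), h3 _ (by omega),
      (stable_comp_iso φ.symm U).2 hU⟩, ?_⟩
    rw [← h2, ← h2]; omega

end SatisfactoryPartition

/-! ### Vertex sets of expressions: finite and nonempty -/

namespace CExpr

variable {c : ℕ}

instance instFintypeVert : (T : CExpr c) → Fintype T.Vert
  | leaf _ => inferInstanceAs (Fintype Unit)
  | union S T =>
    letI := instFintypeVert S
    letI := instFintypeVert T
    inferInstanceAs (Fintype (S.Vert ⊕ T.Vert))
  | relabel _ _ _ T => instFintypeVert T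
  | join _ _ _ T => instFintypeVert T

instance instNonemptyVert : (T : CExpr c) → Nonempty T.Vert
  | leaf _ => inferInstanceAs (Nonempty Unit)
  | union S T =>
    letI := instNonemptyVert S
    inferInstanceAs (Nonempty (S.Vert ⊕ T.Vert))
  | relabel _ _ _ T => instNonemptyVert T
  | join _ _ _ T => instNonemptyVert T

theorem size_pos (T : CExpr c) : 0 < T.size := by
  cases T <;> simp [size]

theorem card_vert_union (S T : CExpr c) :
    Fintype.card (union S T).Vert = Fintype.card S.Vert + Fintype.card T.Vert :=
  Fintype.card_sum

/-! ### Irredundant expressions -/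

theorem addCount_join (i j : Fin c) (hij : i ≠ j) (T : CExpr c) (u v : T.Vert) :
    (join i j hij T).addCount u v = T.addCount u v +
      if (T.label u = i ∧ T.label v = j) ∨ (T.label u = j ∧ T.label v = i) then 1 else 0 := rfl

theorem adj_join_iff {i j : Fin c} {hij : i ≠ j} {T : CExpr c} (u v : T.Vert) :
    (join i j hij T).graph.Adj u v ↔ T.graph.Adj u v ∨
      ((T.label u = i ∧ T.label v = j) ∨ (T.label u = j ∧ T.label v = i)) := by
  have h : (join i j hij T).graph.Adj u v ↔ T.graph.Adj u v ∨
    (SimpleGraph.fromRel fun u v => T.label u = i ∧ T.label v = j).Adj u v := Iff.rfl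
  rw [h, SimpleGraph.fromRel_adj]
  have : ((T.label u = i ∧ T.label v = j) ∨ (T.label v = i ∧ T.label u = j)) → u ≠ v := by
    rintro (⟨h1, h2⟩ | ⟨h1, h2⟩) rfl
    · exact hij (h1.symm.trans h2)
    · exact hij (h1.symm.trans h2)
  tauto

theorem addCount_pos_of_adj (T : CExpr c) {u v : T.Vert} (h : T.graph.Adj u v) :
    1 ≤ T.addCount u v := by
  induction T with
  | leaf i => exact h.elim
  | union S T ihS ihT =>
    cases u <;> cases v
    · exact ihS (by simpa [graph] using h)
    · simp [graph] at h
    · simp [graph] at h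
    · exact ihT (by simpa [graph] using h)
  | relabel i j hij T ih => exact ih h
  | join i j hij T ih =>
    rw [show (join i j hij T).addCount u v = _ from addCount_join i j hij T u v]
    rcases (adj_join_iff (T := T) u v).1 h with h' | h'
    · have := ih h'
      omega
    · rw [if_pos h']
      omega

theorem Irredundant.union_left {S T : CExpr c} (h : (union S T).Irredundant) : S.Irredundant :=
  fun u v huv => h (Sum.inl u) (Sum.inl v) (by simpa [graph] using huv)

theorem Irredundant.union_right {S T : CExpr c} (h : (union S T).Irredundant) : T.Irredundant :=
  fun u v huv => h (Sum.inr u) (Sum.inr v) (by simpa [graph] using huv)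

theorem Irredundant.of_relabel {i j : Fin c} {hij : i ≠ j} {T : CExpr c}
    (h : (relabel i j hij T).Irredundant) : T.Irredundant := h

/-- An edge present below the join is already counted there, so a total of 1 leaves exactly 1 below.
-/
theorem Irredundant.of_join {i j : Fin c} {hij : i ≠ j} {T : CExpr c}
    (h : (join i j hij T).Irredundant) : T.Irredundant := by
  intro u v huv
  have h1 := h u v ((adj_join_iff u v).2 (.inl huv))
  have h2 := T.addCount_pos_of_adj huv
  rw [addCount_join] at h1
  omega

/-- Such an edge would be counted once below and again at the join. Irredundancy acts on the
recursion only through this fact. -/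
theorem Irredundant.not_adj {i j : Fin c} {hij : i ≠ j} {T : CExpr c}
    (h : (join i j hij T).Irredundant) (u v : T.Vert)
    (huv : (T.label u = i ∧ T.label v = j) ∨ (T.label u = j ∧ T.label v = i)) :
    ¬ T.graph.Adj u v := by
  intro hadj
  have h1 := h u v ((adj_join_iff u v).2 (.inl hadj))
  have h2 := T.addCount_pos_of_adj hadj
  rw [addCount_join, if_pos huv] at h1
  omega

/-! ### Profiles: the numbers of vertices of each label in the two parts -/

/-- The digits `0, …, c - 1` belong to the labels in the first part, the digits `c, …, 2c - 1` to
those in the second part. -/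
def digitIndex (l : Fin c) (b : Bool) : ℕ := if b then l else c + l

theorem digitIndex_lt (l : Fin c) (b : Bool) : digitIndex l b < 2 * c := by
  have := l.2
  unfold digitIndex
  split_ifs <;> omega

/-- The number of vertices of each label in each part, written in base `B`. -/
def profile (B : ℕ) (T : CExpr c) (U : T.Vert → Bool) : ℕ :=
  ∑ v, B ^ digitIndex (T.label v) (U v)

/-- The number of vertices that are counted by the digit `k`. -/
def count (T : CExpr c) (U : T.Vert → Bool) (k : ℕ) : ℕ :=
  (Finset.univ.filter fun v => digitIndex (T.label v) (U v) = k).card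

theorem count_le_card (T : CExpr c) (U : T.Vert → Bool) (k : ℕ) :
    T.count U k ≤ Fintype.card T.Vert := Finset.card_filter_le _ _

/-- Vertices are grouped by their digit. Once `B` exceeds the number of vertices there are no
carries and the counts are the digits. -/
theorem profile_eq_sum (B : ℕ) (T : CExpr c) (U : T.Vert → Bool) :
    profile B T U = ∑ k ∈ Finset.range (2 * c), T.count U k * B ^ k := by
  unfold profile count
  rw [← Finset.sum_fiberwise_of_maps_to (s := Finset.univ) (t := Finset.range (2 * c))
    (g := fun v => digitIndex (T.label v) (U v))
    (fun v _ => Finset.mem_range.2 (digitIndex_lt _ _))]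
  refine Finset.sum_congr rfl fun k _ => ?_
  rw [Finset.card_eq_sum_ones, Finset.sum_mul]
  refine Finset.sum_congr rfl fun v hv => ?_
  rw [(Finset.mem_filter.1 hv).2, one_mul]

theorem count_lt {B : ℕ} {T : CExpr c} (hB : Fintype.card T.Vert < B) (U : T.Vert → Bool)
    (k : ℕ) : T.count U k < B := (T.count_le_card U k).trans_lt hB

theorem profile_lt {B : ℕ} {T : CExpr c} (hB : Fintype.card T.Vert < B) (U : T.Vert → Bool) :
    profile B T U < B ^ (2 * c) := by
  rw [profile_eq_sum]
  exact sum_digits_lt_pow (count_lt hB U) _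

theorem profile_digit {B : ℕ} {T : CExpr c} (hB : Fintype.card T.Vert < B) (U : T.Vert → Bool)
    {k : ℕ} (hk : k < 2 * c) : profile B T U / B ^ k % B = T.count U k := by
  rw [profile_eq_sum]
  exact sum_digits_digit (count_lt hB U) hk

theorem digitIndex_eq_iff (l i : Fin c) (b : Bool) :
    (digitIndex l b = i ↔ l = i ∧ b = true) ∧ (digitIndex l b = c + i ↔ l = i ∧ b = false) := by
  have := l.2
  have := i.2
  simp only [digitIndex, Fin.ext_iff]
  cases b <;> simp <;> omega

/-- The difference of the numbers of vertices of label `l` in the two parts. -/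
theorem sum_label_eq (T : CExpr c) (U : T.Vert → Bool) (l : Fin c) :
    ∑ u, (if T.label u = l then (if U u then (-1 : ℤ) else 1) else 0) =
      T.count U (c + l) - T.count U l := by
  simp only [count, Finset.card_filter, Nat.cast_sum, ← Finset.sum_sub_distrib]
  refine Finset.sum_congr rfl fun u _ => ?_
  simp only [(digitIndex_eq_iff _ _ _).1, (digitIndex_eq_iff _ _ _).2]
  cases U u <;> by_cases h : T.label u = l <;> simp [h]

theorem profile_union (B : ℕ) (S T : CExpr c) (U : (union S T).Vert → Bool) :
    profile B (union S T) U =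
      profile B S (fun v => U (Sum.inl v)) + profile B T (fun v => U (Sum.inr v)) :=
  Fintype.sum_sum_type _

/-- The `i`-vertices leave the digits `i` and `c + i` for `j` and `c + j`. What is lost is added on
the left, which avoids truncated subtraction; the program tests this same equation. -/
theorem profile_relabel {B : ℕ} {i j : Fin c} (hij : i ≠ j) (T : CExpr c) (U : T.Vert → Bool) :
    profile B (relabel i j hij T) U + T.count U i * B ^ (i : ℕ) +
      T.count U (c + i) * B ^ (c + i : ℕ) =
    profile B T U + T.count U i * B ^ (j : ℕ) + T.count U (c + i) * B ^ (c + j : ℕ) := by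
  have h1 : profile B (relabel i j hij T) U =
    ∑ v : T.Vert, B ^ digitIndex (if T.label v = i then j else T.label v) (U v) := rfl
  rw [h1]
  simp only [profile, count, Finset.card_filter, Finset.sum_mul, ← Finset.sum_add_distrib]
  refine Finset.sum_congr rfl fun u _ => ?_
  simp only [(digitIndex_eq_iff _ _ _).1, (digitIndex_eq_iff _ _ _).2]
  cases hU : U u <;> by_cases h : T.label u = i <;> simp [h, digitIndex] <;> ring

/-! ### Feasible table entries -/

open SatisfactoryPartition

/-- There is a partition of the represented graph with the given profile that is stable if `x l`
is the excess that the vertices of label `l` get from edges that are added later. -/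
def Feasible (B : ℕ) (T : CExpr c) (γ : ℕ) (x : ℕ → ℤ) : Prop :=
  ∃ U, profile B T U = γ ∧ Stable T.graph U fun v => x (T.label v)

theorem feasible_leaf (B : ℕ) (i : Fin c) (γ : ℕ) (x : ℕ → ℤ) :
    Feasible B (leaf i) γ x ↔
      (γ = B ^ (i : ℕ) ∧ x i ≤ 0) ∨ (γ = B ^ (c + i : ℕ) ∧ 0 ≤ x i) := by
  have hp : ∀ U : Unit → Bool, profile B (leaf i) U = B ^ digitIndex i (U ()) :=
    fun U => Fintype.sum_unique (ι := Unit) _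
  have hs : ∀ U : Unit → Bool, Stable (leaf i).graph U (fun v => x ((leaf i).label v)) ↔
      (U () = true → x i ≤ 0) ∧ (U () = false → 0 ≤ x i) := by
    intro U
    show (∀ v : Unit, (U v = true → excess (⊥ : SimpleGraph Unit) U v + x i ≤ 0) ∧
      (U v = false → 0 ≤ excess (⊥ : SimpleGraph Unit) U v + x i)) ↔ _
    simp only [excess_bot, zero_add]
    exact ⟨fun h => h (), fun h _ => h⟩
  constructor
  · rintro ⟨U, rfl, hU⟩
    have h1 := (hs U).1 hU
    rw [show profile B (leaf i) U = _ from hp U]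
    cases h : U () <;> simp_all [digitIndex]
  · rintro (⟨rfl, h⟩ | ⟨rfl, h⟩)
    · exact ⟨fun _ => true, (hp _).trans (by simp [digitIndex]), (hs _).2 (by simpa using h)⟩
    · exact ⟨fun _ => false, (hp _).trans (by simp [digitIndex]), (hs _).2 (by simpa using h)⟩

theorem stable_union (S T : CExpr c) (U : (union S T).Vert → Bool) (x : ℕ → ℤ) :
    Stable (union S T).graph U (fun v => x ((union S T).label v)) ↔
      Stable S.graph (fun v => U (Sum.inl v)) (fun v => x (S.label v)) ∧
      Stable T.graph (fun v => U (Sum.inr v)) (fun v => x (T.label v)) := by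
  have hl : ∀ v, excess (union S T).graph U (Sum.inl v) =
      excess S.graph (fun v => U (Sum.inl v)) v := excess_sum_inl S.graph T.graph U
  have hr : ∀ v, excess (union S T).graph U (Sum.inr v) =
      excess T.graph (fun v => U (Sum.inr v)) v := excess_sum_inr S.graph T.graph U
  constructor
  · intro h
    constructor
    · intro v
      have := h (Sum.inl v)
      rwa [hl] at this
    · intro v
      have := h (Sum.inr v)
      rwa [hr] at this
  · rintro ⟨h1, h2⟩ (v | v)
    · rw [hl]; exact h1 v
    · rw [hr]; exact h2 v

/-- Partitions of a disjoint union are pairs of partitions, their profiles add up, and no edge runs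
between the two sides. The condition `γ' ≤ γ` keeps the subtraction honest. -/
theorem feasible_union (B : ℕ) (S T : CExpr c) (γ : ℕ) (x : ℕ → ℤ) :
    Feasible B (union S T) γ x ↔
      ∃ γ', γ' ≤ γ ∧ Feasible B S γ' x ∧ Feasible B T (γ - γ') x := by
  constructor
  · rintro ⟨U, rfl, hU⟩
    rw [stable_union] at hU
    exact ⟨_, by rw [profile_union]; exact Nat.le_add_right _ _, ⟨_, rfl, hU.1⟩,
      ⟨_, by rw [profile_union]; omega, hU.2⟩⟩
  · rintro ⟨γ', hle, ⟨U, hU, hU'⟩, ⟨V, hV, hV'⟩⟩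
    refine ⟨Sum.elim U V, ?_, (stable_union _ _ _ _).2 ⟨hU', hV'⟩⟩
    have h : profile B (S.union T) (Sum.elim U V) = profile B S U + profile B T V :=
      profile_union B S T (Sum.elim U V)
    exact h.trans (by omega)

/-- An `i`-vertex gains all `j`-vertices as neighbours and vice versa. By `Irredundant.not_adj` none
of them was a neighbour before, so the contributions add. -/
theorem excess_join {i j : Fin c} {hij : i ≠ j} {T : CExpr c}
    (hT : (join i j hij T).Irredundant) (U : T.Vert → Bool) (v : T.Vert) :
    excess (join i j hij T).graph U v = excess T.graph U v +
      (if T.label v = i then (T.count U (c + j) - T.count U j : ℤ) else 0) +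
      (if T.label v = j then (T.count U (c + i) - T.count U i : ℤ) else 0) := by
  classical
  have hsum : ∀ (p : Prop) [Decidable p] (f : T.Vert → ℤ),
      (if p then ∑ u, f u else 0) = ∑ u, if p then f u else 0 := by
    intro p _ f
    split_ifs <;> simp
  -- Restated over `T.Vert`, so that all sums have the same index type.
  have hex : excess (join i j hij T).graph U v =
      ∑ u : T.Vert, if (join i j hij T).graph.Adj v u then (if U u then (-1 : ℤ) else 1)
        else 0 := by
    unfold excess
    exact Finset.sum_congr rfl fun u _ => by congr
  rw [hex, ← sum_label_eq, ← sum_label_eq, hsum, hsum]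
  unfold excess
  rw [← Finset.sum_add_distrib, ← Finset.sum_add_distrib]
  refine Finset.sum_congr rfl fun u _ => ?_
  have hn := hT.not_adj v u
  simp only [adj_join_iff]
  by_cases h1 : T.label v = i
  · have h2 : T.label v ≠ j := fun h => hij (h1.symm.trans h)
    by_cases h3 : T.label u = j
    · simp [h1, h3, hij, hn (.inl ⟨h1, h3⟩)]
    · simp [h1, h3, hij]
  · by_cases h2 : T.label v = j
    · by_cases h3 : T.label u = i
      · simp [h2, h3, hij.symm, hn (.inr ⟨h2, h3⟩)]
      · simp [h2, h3, hij.symm]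
    · simp [h1, h2]

/-- Relabelling merges two classes, so `γ` does not determine the profile below and a search is
needed. Former `i`-vertices will receive the later excess of label `j`. -/
theorem feasible_relabel {B : ℕ} {i j : Fin c} (hij : i ≠ j) {T : CExpr c}
    (hB : Fintype.card T.Vert < B) (γ : ℕ) (x : ℕ → ℤ) :
    Feasible B (relabel i j hij T) γ x ↔ ∃ γ', γ' < B ^ (2 * c) ∧
      γ + γ' / B ^ (i : ℕ) % B * B ^ (i : ℕ) + γ' / B ^ (c + i : ℕ) % B * B ^ (c + i : ℕ) =
        γ' + γ' / B ^ (i : ℕ) % B * B ^ (j : ℕ) + γ' / B ^ (c + i : ℕ) % B * B ^ (c + j : ℕ) ∧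
      Feasible B T γ' (Function.update x i (x j)) := by
  have hi := i.2
  have hx : ∀ v, x ((relabel i j hij T).label v) =
      Function.update x i (x j) (T.label v) := by
    intro v
    show x ((if T.label v = i then j else T.label v : Fin c) : ℕ) = _
    by_cases h : T.label v = i
    · simp [h]
    · rw [if_neg h, Function.update_of_ne]
      exact fun h' => h (Fin.ext h')
  have hs : ∀ U : T.Vert → Bool, Stable (relabel i j hij T).graph U
      (fun v => x ((relabel i j hij T).label v)) ↔
      Stable T.graph U fun v => Function.update x i (x j) (T.label v) := by
    intro U
    simp only [hx]
    exact Iff.rfl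
  constructor
  · rintro ⟨U, rfl, hU⟩
    refine ⟨profile B T U, profile_lt hB U, ?_, U, rfl, (hs U).1 hU⟩
    rw [profile_digit hB U (by omega), profile_digit hB U (by omega)]
    exact profile_relabel hij T U
  · rintro ⟨_, -, h, U, rfl, hU⟩
    refine ⟨U, ?_, (hs U).2 hU⟩
    have := profile_relabel (B := B) hij T U
    rw [profile_digit hB U (by omega), profile_digit hB U (by omega)] at h
    omega

/-- The excess vector below a join node with labels `i` and `j`, if the profile is `γ`. -/
def joinShift (B : ℕ) (i j : Fin c) (γ : ℕ) (x : ℕ → ℤ) (l : ℕ) : ℤ :=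
  x l + (if l = i then ((γ / B ^ (c + j : ℕ) % B : ℕ) : ℤ) - (γ / B ^ (j : ℕ) % B : ℕ) else 0) +
    (if l = j then ((γ / B ^ (c + i : ℕ) % B : ℕ) : ℤ) - (γ / B ^ (i : ℕ) % B : ℕ) else 0)

/-- Vertices, labels and profile do not change. The shift depends on `U` only through its counts,
which are digits of `γ`, so it is known before `U` is. -/
theorem feasible_join {B : ℕ} {i j : Fin c} {hij : i ≠ j} {T : CExpr c}
    (hB : Fintype.card T.Vert < B) (hT : (join i j hij T).Irredundant) (γ : ℕ) (x : ℕ → ℤ) :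
    Feasible B (join i j hij T) γ x ↔ Feasible B T γ (joinShift B i j γ x) := by
  have hi := i.2
  have hj := j.2
  refine exists_congr fun U : T.Vert → Bool => and_congr_right fun hU => ?_
  have hU' : profile B T U = γ := hU
  refine forall_congr' fun v : T.Vert => ?_
  have hl : (join i j hij T).label v = T.label v := rfl
  have : excess (join i j hij T).graph U v + x ((join i j hij T).label v) =
      excess T.graph U v + joinShift B i j γ x (T.label v) := by
    rw [excess_join hT, hl, ← hU', joinShift, profile_digit hB U (by omega),
      profile_digit hB U (by omega), profile_digit hB U (by omega), profile_digit hB U (by omega)]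
    simp only [Fin.ext_iff]
    ring
  rw [this]

/-- One step of the recursion for `Feasible`. -/
def Hit (B : ℕ) : CExpr c → ℕ → ℕ → (ℕ → ℤ) → Prop
  | leaf i, γ, _, x => (γ = B ^ (i : ℕ) ∧ x i ≤ 0) ∨ (γ = B ^ (c + i : ℕ) ∧ 0 ≤ x i)
  | union S T, γ, γ', x => γ' ≤ γ ∧ Feasible B S γ' x ∧ Feasible B T (γ - γ') x
  | relabel i j _ T, γ, γ', x =>
      γ + γ' / B ^ (i : ℕ) % B * B ^ (i : ℕ) + γ' / B ^ (c + i : ℕ) % B * B ^ (c + i : ℕ) =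
        γ' + γ' / B ^ (i : ℕ) % B * B ^ (j : ℕ) + γ' / B ^ (c + i : ℕ) % B * B ^ (c + j : ℕ) ∧
      Feasible B T γ' (Function.update x i (x j))
  | join i j _ T, γ, γ', x => γ = γ' ∧ Feasible B T γ' (joinShift B i j γ' x)

theorem Feasible.lt {B : ℕ} {T : CExpr c} (hB : Fintype.card T.Vert < B) {γ : ℕ} {x : ℕ → ℤ}
    (h : Feasible B T γ x) : γ < B ^ (2 * c) := by
  obtain ⟨U, rfl, -⟩ := h
  exact profile_lt hB U

/-- The uniform shape lets one loop treat all nodes: a leaf ignores `γ'`, a join forces it to equal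
`γ`, and at a union it is bounded as the profile of a child. -/
theorem feasible_iff_hit {B : ℕ} {T : CExpr c} (hB : Fintype.card T.Vert < B)
    (hT : T.Irredundant) (γ : ℕ) (x : ℕ → ℤ) :
    Feasible B T γ x ↔ ∃ γ' < B ^ (2 * c), Hit B T γ γ' x := by
  cases T with
  | leaf i =>
    have h0 : 0 < B := (Nat.zero_le _).trans_lt hB
    rw [feasible_leaf]
    exact ⟨fun h => ⟨0, pow_pos h0 _, h⟩, fun ⟨_, _, h⟩ => h⟩
  | union S T =>
    rw [card_vert_union] at hB
    rw [feasible_union]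
    exact ⟨fun ⟨γ', h⟩ => ⟨γ', h.2.1.lt (by omega), h⟩, fun ⟨γ', _, h⟩ => ⟨γ', h⟩⟩
  | relabel i j hij T => exact feasible_relabel (T := T) hij hB γ x
  | join i j hij T =>
    rw [feasible_join (T := T) hB hT]
    constructor
    · exact fun h => ⟨γ, Feasible.lt (T := T) hB h, rfl, h⟩
    · rintro ⟨_, -, rfl, h⟩
      exact h

/-! ### The answer at the root -/

theorem sum_count_add (T : CExpr c) (U : T.Vert → Bool) :
    (∑ k ∈ Finset.range c, T.count U k = (Finset.univ.filter fun v => U v = true).card) ∧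
    ∑ k ∈ Finset.range c, T.count U (c + k) = (Finset.univ.filter fun v => U v = false).card := by
  have key : ∀ b : Bool, ∑ k : Fin c,
      (Finset.univ.filter fun v => T.label v = k ∧ U v = b).card =
        (Finset.univ.filter fun v => U v = b).card := by
    intro b
    rw [Finset.card_eq_sum_card_fiberwise (f := T.label) (t := Finset.univ) (by simp)]
    refine Finset.sum_congr rfl fun k _ => ?_
    rw [Finset.filter_filter]
    congr 1
    ext v
    simp [and_comm]
  constructor
  · rw [← key true, Finset.sum_range]
    refine Finset.sum_congr rfl fun k _ => ?_
    simp only [count, (digitIndex_eq_iff _ _ _).1]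
  · rw [← key false, Finset.sum_range]
    refine Finset.sum_congr rfl fun k _ => ?_
    simp only [count, (digitIndex_eq_iff _ _ _).2]

/-- The first part occupies the lower `c` digits and the second part the upper ones, so remainder
and quotient by `B ^ c` separate the two parts. -/
theorem profile_mod {B : ℕ} {T : CExpr c} (hB : Fintype.card T.Vert < B) (U : T.Vert → Bool) :
    profile B T U % B ^ c = ∑ k ∈ Finset.range c, T.count U k * B ^ k := by
  rw [profile_eq_sum, two_mul, sum_digits_mod_pow (count_lt hB U)]

theorem profile_div {B : ℕ} {T : CExpr c} (hB : Fintype.card T.Vert < B) (U : T.Vert → Bool) :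
    profile B T U / B ^ c = ∑ k ∈ Finset.range c, T.count U (c + k) * B ^ k := by
  rw [profile_eq_sum, two_mul, sum_digits_div_pow (count_lt hB U)]

theorem sum_digits_ne_zero {B : ℕ} (hB : 0 < B) (f : ℕ → ℕ) (N : ℕ) :
    ∑ k ∈ Finset.range N, f k * B ^ k ≠ 0 ↔ 0 < ∑ k ∈ Finset.range N, f k := by
  rw [Nat.pos_iff_ne_zero]
  simp [Finset.sum_eq_zero_iff, hB.ne']

theorem profile_mod_ne_zero {B : ℕ} {T : CExpr c} (hB : Fintype.card T.Vert < B)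
    (U : T.Vert → Bool) : profile B T U % B ^ c ≠ 0 ↔ ∃ v, U v = true := by
  rw [profile_mod hB, sum_digits_ne_zero ((Nat.zero_le _).trans_lt hB), (sum_count_add T U).1,
    Finset.card_pos]
  simp [Finset.Nonempty]

theorem profile_div_ne_zero {B : ℕ} {T : CExpr c} (hB : Fintype.card T.Vert < B)
    (U : T.Vert → Bool) : profile B T U / B ^ c ≠ 0 ↔ ∃ v, U v = false := by
  rw [profile_div hB, sum_digits_ne_zero ((Nat.zero_le _).trans_lt hB)
    (fun k => T.count U (c + k)), (sum_count_add T U).2, Finset.card_pos]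
  simp [Finset.Nonempty]

/-- As `n + 1 ≡ 1` modulo `n`, a number in base `n + 1` is congruent to its digit sum, here the size
of the first part. The size `n` is reduced to 0, but neither value is half of `n > 0`. -/
theorem profile_mod_mod {n : ℕ} {T : CExpr c} (hn : Fintype.card T.Vert = n)
    (U : T.Vert → Bool) : 2 * (profile (n + 1) T U % (n + 1) ^ c % n) = n ↔
      2 * (Finset.univ.filter fun v => U v = true).card = n := by
  have h0 : 0 < n := hn ▸ Fintype.card_pos
  have h1 : (Finset.univ.filter fun v => U v = true).card ≤ n := hn ▸ Finset.card_filter_le _ _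
  have h2 : profile (n + 1) T U % (n + 1) ^ c % n =
      (Finset.univ.filter fun v => U v = true).card % n := by
    rw [profile_mod (by omega), ← (sum_count_add T U).1]
    refine Nat.ModEq.sum fun k _ => ?_
    have : (n + 1) ^ k ≡ 1 [MOD n] := by
      simpa using (show n + 1 ≡ 1 [MOD n] by simp [Nat.ModEq]).pow k
    simpa using this.mul_left (T.count U k)
  rw [h2]
  rcases h1.lt_or_eq with h | h
  · rw [Nat.mod_eq_of_lt h]
  · rw [h, Nat.mod_self]; omega

theorem hasSatisfactoryPartition_iff_feasible {n : ℕ} {G : SimpleGraph (Fin n)} {T : CExpr c}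
    (h : T.Represents G) : HasSatisfactoryPartition G ↔
      ∃ γ < (n + 1) ^ (2 * c), Feasible (n + 1) T γ 0 ∧ γ % (n + 1) ^ c ≠ 0 ∧
        γ / (n + 1) ^ c ≠ 0 := by
  obtain ⟨φ⟩ := h
  have hB : Fintype.card T.Vert < n + 1 := by
    rw [Fintype.card_congr φ.toEquiv, Fintype.card_fin]; omega
  rw [hasSatisfactoryPartition_iff φ]
  constructor
  · rintro ⟨U, h1, h2, hU⟩
    exact ⟨_, profile_lt hB U, ⟨U, rfl, hU⟩, (profile_mod_ne_zero hB U).2 h1,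
      (profile_div_ne_zero hB U).2 h2⟩
  · rintro ⟨_, -, ⟨U, rfl, hU⟩, h1, h2⟩
    exact ⟨U, (profile_mod_ne_zero hB U).1 h1, (profile_div_ne_zero hB U).1 h2, hU⟩

theorem hasBalancedSatisfactoryPartition_iff_feasible {n : ℕ} {G : SimpleGraph (Fin n)}
    {T : CExpr c} (h : T.Represents G) : HasBalancedSatisfactoryPartition G ↔
      ∃ γ < (n + 1) ^ (2 * c), Feasible (n + 1) T γ 0 ∧
        2 * (γ % (n + 1) ^ c % n) = n := by
  obtain ⟨φ⟩ := h
  have hn : Fintype.card T.Vert = n := by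
    rw [Fintype.card_congr φ.toEquiv, Fintype.card_fin]
  rw [hasBalancedSatisfactoryPartition_iff φ, hn]
  constructor
  · rintro ⟨U, h1, hU⟩
    exact ⟨_, profile_lt (by omega) U, ⟨U, rfl, hU⟩, (profile_mod_mod hn U).2 h1⟩
  · rintro ⟨_, -, ⟨U, rfl, hU⟩, h1⟩
    exact ⟨U, (profile_mod_mod hn U).1 h1, hU⟩

end CExpr

namespace CExpr

variable {c : ℕ}

/-! ### The subtree at a position in postorder -/

/-- The subtree whose root is the node number `t` in postorder. -/
def nodeAt : CExpr c → ℕ → CExpr c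
  | leaf i, _ => leaf i
  | union S T, t =>
    if t < S.size then S.nodeAt t
    else if t < S.size + T.size then T.nodeAt (t - S.size) else union S T
  | relabel i j h T, t => if t < T.size then T.nodeAt t else relabel i j h T
  | join i j h T, t => if t < T.size then T.nodeAt t else join i j h T

/-- The children of a node and their positions, if the node is at position `t` of `R`. -/
def ChildrenAt (R : CExpr c) (t : ℕ) : CExpr c → Prop
  | leaf _ => True
  | union S T => T.size + 1 ≤ t ∧ R.nodeAt (t - 1) = T ∧ R.nodeAt (t - 1 - T.size) = S
  | relabel _ _ _ T => 1 ≤ t ∧ R.nodeAt (t - 1) = T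
  | join _ _ _ T => 1 ≤ t ∧ R.nodeAt (t - 1) = T

theorem nodeAt_last (T : CExpr c) : T.nodeAt (T.size - 1) = T := by
  cases T with
  | leaf i => rfl
  | union S T =>
    rw [show (union S T).size - 1 = S.size + T.size from rfl]
    simp only [nodeAt]
    rw [if_neg (by omega), if_neg (by omega)]
  | relabel i j h T => simp [nodeAt, size]
  | join i j h T => simp [nodeAt, size]

/-- A property that is inherited by children is inherited by subtrees. -/
theorem nodeAt_induction {P : CExpr c → Prop} (hl : ∀ S T, P (union S T) → P S)
    (hr : ∀ S T, P (union S T) → P T) (hrel : ∀ i j h T, P (relabel i j h T) → P T)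
    (hjoin : ∀ i j h T, P (join i j h T) → P T) (T : CExpr c) (hT : P T) (t : ℕ) :
    P (T.nodeAt t) := by
  induction T generalizing t with
  | leaf i => exact hT
  | union S T ihS ihT =>
    simp only [nodeAt]
    split_ifs
    · exact ihS (hl _ _ hT) _
    · exact ihT (hr _ _ hT) _
    · exact hT
  | relabel i j h T ih =>
    simp only [nodeAt]
    split_ifs
    · exact ih (hrel _ _ _ _ hT) _
    · exact hT
  | join i j h T ih =>
    simp only [nodeAt]
    split_ifs
    · exact ih (hjoin _ _ _ _ hT) _
    · exact hT

theorem Irredundant.nodeAt {T : CExpr c} (hT : T.Irredundant) (t : ℕ) :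
    (T.nodeAt t).Irredundant :=
  nodeAt_induction (fun _ _ h => h.union_left) (fun _ _ h => h.union_right)
    (fun _ _ _ _ h => h.of_relabel) (fun _ _ _ _ h => h.of_join) T hT t

theorem card_vert_nodeAt_le (T : CExpr c) (t : ℕ) :
    Fintype.card (T.nodeAt t).Vert ≤ Fintype.card T.Vert :=
  nodeAt_induction (P := fun S => Fintype.card S.Vert ≤ Fintype.card T.Vert)
    (fun S T h => by rw [card_vert_union] at h; omega)
    (fun S T h => by rw [card_vert_union] at h; omega)
    (fun _ _ _ _ h => h) (fun _ _ _ _ h => h) T le_rfl t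

theorem size_nodeAt_le (T : CExpr c) (t : ℕ) : (T.nodeAt t).size ≤ T.size :=
  nodeAt_induction (P := fun S => S.size ≤ T.size)
    (fun S T h => by simp only [size] at h; omega)
    (fun S T h => by simp only [size] at h; omega)
    (fun _ _ _ _ h => by simp only [size] at h; omega)
    (fun _ _ _ _ h => by simp only [size] at h; omega) T le_rfl t

/-- A subtree occupies consecutive postorder positions, so inside a larger tree its positions are
merely shifted by some `d`. -/
theorem childrenAt_congr {R R' X : CExpr c} {t d : ℕ}
    (h : ∀ u < t, R'.nodeAt (u + d) = R.nodeAt u) (hX : ChildrenAt R t X) :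
    ChildrenAt R' (t + d) X := by
  cases X with
  | leaf i => trivial
  | union S T =>
    obtain ⟨h1, h2, h3⟩ := hX
    refine ⟨by omega, ?_, ?_⟩
    · rw [← h2, ← h _ (by omega)]; congr 1; omega
    · rw [← h3, ← h _ (by omega)]; congr 1; omega
  | relabel i j hij T =>
    obtain ⟨h1, h2⟩ := hX
    refine ⟨by omega, ?_⟩
    rw [← h2, ← h _ (by omega)]; congr 1; omega
  | join i j hij T =>
    obtain ⟨h1, h2⟩ := hX
    refine ⟨by omega, ?_⟩
    rw [← h2, ← h _ (by omega)]; congr 1; omega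

/-- In postorder a root directly follows the root of its last child; at a union, stepping over all
nodes of that child leads to the root of the other one. -/
theorem childrenAt_nodeAt (T : CExpr c) {t : ℕ} (ht : t < T.size) :
    ChildrenAt T t (T.nodeAt t) := by
  induction T generalizing t with
  | leaf i => trivial
  | union S T ihS ihT =>
    have hS : ∀ u < S.size, (union S T).nodeAt u = S.nodeAt u := fun u hu => by
      simp only [nodeAt, if_pos hu]
    have hT : ∀ u < T.size, (union S T).nodeAt (u + S.size) = T.nodeAt u := fun u hu => by
      simp only [nodeAt]
      rw [if_neg (by omega), if_pos (by omega), Nat.add_sub_cancel]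
    have hSp := S.size_pos
    have hTp := T.size_pos
    simp only [size] at ht
    rcases lt_or_ge t S.size with h | h
    · rw [hS t h]
      exact childrenAt_congr (d := 0) (fun u hu => hS u (by omega)) (ihS h)
    · obtain ⟨u, rfl⟩ := Nat.exists_eq_add_of_le' h
      rcases lt_or_ge u T.size with h' | h'
      · rw [hT u h']
        exact childrenAt_congr (fun v hv => hT v (by omega)) (ihT h')
      · obtain rfl : u = T.size := by omega
        have hn : (union S T).nodeAt (T.size + S.size) = union S T := by
          simp only [nodeAt]
          rw [if_neg (by omega), if_neg (by omega)]
        rw [hn]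
        refine ⟨by omega, ?_, ?_⟩
        · have := hT (T.size - 1) (by omega)
          rw [nodeAt_last] at this
          refine Eq.trans ?_ this
          congr 1; omega
        · have := hS (S.size - 1) (by omega)
          rw [nodeAt_last] at this
          refine Eq.trans ?_ this
          congr 1; omega
  | relabel i j hij T ih =>
    have hT : ∀ u < T.size, (relabel i j hij T).nodeAt u = T.nodeAt u := fun u hu => by
      simp only [nodeAt, if_pos hu]
    have hTp := T.size_pos
    simp only [size] at ht
    rcases lt_or_ge t T.size with h | h
    · rw [hT t h]
      exact childrenAt_congr (d := 0) (fun u hu => hT u (by omega)) (ih h)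
    · obtain rfl : t = T.size := by omega
      rw [show (relabel i j hij T).nodeAt T.size = relabel i j hij T by simp [nodeAt]]
      exact ⟨hTp, by rw [hT _ (by omega), nodeAt_last]⟩
  | join i j hij T ih =>
    have hT : ∀ u < T.size, (join i j hij T).nodeAt u = T.nodeAt u := fun u hu => by
      simp only [nodeAt, if_pos hu]
    have hTp := T.size_pos
    simp only [size] at ht
    rcases lt_or_ge t T.size with h | h
    · rw [hT t h]
      exact childrenAt_congr (d := 0) (fun u hu => hT u (by omega)) (ih h)
    · obtain rfl : t = T.size := by omega
      rw [show (join i j hij T).nodeAt T.size = join i j hij T by simp [nodeAt]]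
      exact ⟨hTp, by rw [hT _ (by omega), nodeAt_last]⟩

/-! ### The code of an expression -/

/-- The three numbers that encode the root. -/
def head : CExpr c → List ℕ
  | leaf i => [0, (i : ℕ), 0]
  | union _ _ => [1, 0, 0]
  | relabel i j _ _ => [2, (i : ℕ), (j : ℕ)]
  | join i j _ _ => [3, (i : ℕ), (j : ℕ)]

theorem code_length (T : CExpr c) : T.code.length = 3 * T.size := by
  induction T with
  | leaf i => rfl
  | union S T ihS ihT => simp [code, size, ihS, ihT]; ring
  | relabel i j h T ih => simp [code, size, ih]; ring
  | join i j h T ih => simp [code, size, ih]; ring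

theorem code_getD (T : CExpr c) {t : ℕ} (ht : t < T.size) {e : ℕ} (he : e < 3) :
    T.code.getD (3 * t + e) 0 = (T.nodeAt t).head.getD e 0 := by
  induction T generalizing t with
  | leaf i =>
    obtain rfl : t = 0 := by simp only [size] at ht; omega
    simp [code, head, nodeAt]
  | union S T ihS ihT =>
    have hS := S.code_length
    have hT := T.code_length
    simp only [size] at ht
    simp only [code, nodeAt]
    split_ifs with h1 h2
    · rw [List.append_assoc, List.getD_append _ _ _ _ (by omega), ihS h1]
    · rw [List.append_assoc, List.getD_append_right _ _ _ _ (by omega),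
        List.getD_append _ _ _ _ (by omega), ← ihT (by omega)]
      congr 1; omega
    · rw [List.getD_append_right _ _ _ _ (by simp; omega)]
      simp only [head, List.length_append]
      congr 1; omega
  | relabel i j h T ih =>
    have hT := T.code_length
    simp only [size] at ht
    simp only [code, nodeAt]
    split_ifs with h1
    · rw [List.getD_append _ _ _ _ (by omega), ih h1]
    · rw [List.getD_append_right _ _ _ _ (by omega)]
      simp only [head]
      congr 1; omega
  | join i j h T ih =>
    have hT := T.code_length
    simp only [size] at ht
    simp only [code, nodeAt]
    split_ifs with h1
    · rw [List.getD_append _ _ _ _ (by omega), ih h1]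
    · rw [List.getD_append_right _ _ _ _ (by omega)]
      simp only [head]
      congr 1; omega

theorem code_lt (T : CExpr c) : ∀ a ∈ T.code, a < c + 4 := by
  induction T with
  | leaf i => simp [code]; omega
  | union S T ihS ihT =>
    simp only [code, List.mem_append]
    rintro a ((h | h) | h)
    · exact ihS a h
    · exact ihT a h
    · simp at h; omega
  | relabel i j h T ih =>
    have := i.2
    have := j.2
    simp only [code, List.mem_append]
    rintro a (h | h)
    · exact ih a h
    · simp at h; omega
  | join i j h T ih =>
    have := i.2
    have := j.2
    simp only [code, List.mem_append]
    rintro a (h | h)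
    · exact ih a h
    · simp at h; omega

end CExpr

/-! ### The layout of the input -/

namespace SatisfactoryPartition

theorem inputCode_getD {n c : ℕ} (G : SimpleGraph (Fin n)) (T : CExpr c) :
    (inputCode G T).getD 0 0 = n ∧ (inputCode G T).getD 1 0 = c ∧
    (inputCode G T).getD 2 0 = T.size ∧
    ∀ t < T.size, ∀ e < 3, (inputCode G T).getD (3 + (3 * t + e)) 0 =
      (T.nodeAt t).head.getD e 0 := by
  refine ⟨rfl, rfl, rfl, fun t ht e he => ?_⟩
  have h := T.code_length
  rw [inputCode, List.append_assoc, List.getD_append_right _ _ _ _ (by simp),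
    List.getD_append _ _ _ _ (by simp; omega), ← T.code_getD ht he]
  congr 1
  simp

theorem graphCode_length {n : ℕ} (G : SimpleGraph (Fin n)) :
    (graphCode G).length = n * n := by
  simp [graphCode, List.length_flatMap]

theorem inputCode_length {n c : ℕ} (G : SimpleGraph (Fin n)) (T : CExpr c) :
    (inputCode G T).length = 3 + 3 * T.size + n * n := by
  simp only [inputCode, List.length_append, T.code_length, graphCode_length]
  rfl

theorem inputCode_lt {n c : ℕ} (G : SimpleGraph (Fin n)) (T : CExpr c) (a : ℕ) :
    (inputCode G T).getD a 0 < n + T.size + c + 4 := by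
  rcases lt_or_ge a (inputCode G T).length with h | h
  · rw [List.getD_eq_getElem _ _ h]
    have hm := List.getElem_mem h
    generalize (inputCode G T)[a] = b at hm
    simp only [inputCode, List.mem_append] at hm
    rcases hm with (hm | hm) | hm
    · simp at hm; omega
    · have := T.code_lt b hm
      omega
    · simp only [graphCode, List.mem_flatMap, List.mem_map] at hm
      obtain ⟨u, -, v, -, rfl⟩ := hm
      split_ifs <;> omega
  · rw [List.getD_eq_default _ _ h]; omega

end SatisfactoryPartition

namespace CExpr

variable {c : ℕ}

/-! ### Excess vectors as numbers -/

/-- The vector `x 0, …, x (c - 1)` with entries between `-M` and `M` as a number in base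
`2 * M + 1`. -/
def encode (c M : ℕ) (x : ℕ → ℤ) : ℕ :=
  ∑ l ∈ Finset.range c, (x l + M).toNat * (2 * M + 1) ^ l

theorem toNat_add_lt {M : ℕ} {x : ℕ → ℤ} (hx : ∀ l, |x l| ≤ M) (l : ℕ) :
    (x l + M).toNat < 2 * M + 1 := by
  have := abs_le.1 (hx l)
  omega

theorem encode_lt {c M : ℕ} {x : ℕ → ℤ} (hx : ∀ l, |x l| ≤ M) :
    encode c M x < (2 * M + 1) ^ c := sum_digits_lt_pow (toNat_add_lt hx) c

theorem encode_digit {c M : ℕ} {x : ℕ → ℤ} (hx : ∀ l, |x l| ≤ M) {l : ℕ} (hl : l < c) :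
    encode c M x / (2 * M + 1) ^ l % (2 * M + 1) = (x l + M).toNat :=
  sum_digits_digit (toNat_add_lt hx) hl

theorem cast_encode {c M : ℕ} {x : ℕ → ℤ} (hx : ∀ l, |x l| ≤ M) :
    (encode c M x : ℤ) = ∑ l ∈ Finset.range c, (x l + M) * (2 * M + 1) ^ l := by
  simp only [encode, Nat.cast_sum, Nat.cast_mul, Nat.cast_pow]
  refine Finset.sum_congr rfl fun l _ => ?_
  have := abs_le.1 (hx l)
  rw [Int.toNat_of_nonneg (by omega)]
  push_cast
  rfl

/-- All digits equal `M`, and `2 * M` is the largest digit, so twice the number plus one is the full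
power. This lets the program find the zero vector by one division. -/
theorem encode_zero (c M : ℕ) : encode c M 0 = (2 * M + 1) ^ c / 2 := by
  have h : 2 * encode c M 0 + 1 = (2 * M + 1) ^ c := by
    unfold encode
    induction c with
    | zero => simp
    | succ c ih =>
      rw [Finset.sum_range_succ, mul_add, add_right_comm, ih]
      simp
      ring
  omega

theorem encode_update {c M : ℕ} (x : ℕ → ℤ) {i : ℕ} (j : ℕ) (hi : i < c) :
    encode c M (Function.update x i (x j)) =
      encode c M x + (x j + M).toNat * (2 * M + 1) ^ i - (x i + M).toNat * (2 * M + 1) ^ i := by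
  have h1 : ∀ y : ℕ → ℤ, encode c M y = (y i + M).toNat * (2 * M + 1) ^ i +
      ∑ l ∈ (Finset.range c).erase i, (y l + M).toNat * (2 * M + 1) ^ l := fun y =>
    (Finset.add_sum_erase _ _ (Finset.mem_range.2 hi)).symm
  rw [h1, h1 x, Function.update_self, Finset.sum_congr rfl fun l hl => by
    rw [Function.update_of_ne (Finset.ne_of_mem_erase hl)]]
  omega

/-- For vectors in range the digits are the integers `x l + M`, so the shift acts linearly on the
encoding. All increases precede the decreases, hence the subtraction does not truncate. -/
theorem encode_joinShift {c M B : ℕ} {x : ℕ → ℤ} (hx : ∀ l, |x l| ≤ M) {i j : Fin c} {γ : ℕ}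
    (hx' : ∀ l, |joinShift B i j γ x l| ≤ M) :
    encode c M (joinShift B i j γ x) = encode c M x +
      γ / B ^ (c + j : ℕ) % B * (2 * M + 1) ^ (i : ℕ) +
      γ / B ^ (c + i : ℕ) % B * (2 * M + 1) ^ (j : ℕ) -
      (γ / B ^ (j : ℕ) % B * (2 * M + 1) ^ (i : ℕ) +
        γ / B ^ (i : ℕ) % B * (2 * M + 1) ^ (j : ℕ)) := by
  refine (Nat.sub_eq_of_eq_add ?_).symm
  zify
  rw [cast_encode hx, cast_encode hx']
  have hite : ∀ (k : Fin c) (a : ℤ), ∑ l ∈ Finset.range c,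
      (if l = k then a else 0) * (2 * M + 1 : ℤ) ^ l = a * (2 * M + 1) ^ (k : ℕ) := by
    intro k a
    rw [Finset.sum_eq_single_of_mem (k : ℕ) (Finset.mem_range.2 k.2)
      (fun b _ hb => by simp [hb])]
    simp
  have hsum : ∑ l ∈ Finset.range c, (joinShift B i j γ x l + M) * (2 * M + 1 : ℤ) ^ l =
      ∑ l ∈ Finset.range c, (x l + M) * (2 * M + 1 : ℤ) ^ l +
      (((γ / B ^ (c + j : ℕ) % B : ℕ) : ℤ) - (γ / B ^ (j : ℕ) % B : ℕ)) * (2 * M + 1) ^ (i : ℕ) +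
      (((γ / B ^ (c + i : ℕ) % B : ℕ) : ℤ) - (γ / B ^ (i : ℕ) % B : ℕ)) *
        (2 * M + 1) ^ (j : ℕ) := by
    rw [← hite, ← hite, ← Finset.sum_add_distrib, ← Finset.sum_add_distrib]
    refine Finset.sum_congr rfl fun l _ => ?_
    rw [joinShift]
    ring
  rw [hsum]
  push_cast
  ring

/-- The entries of `x` are so small that they stay within the range of the encoding when one goes
down from a subtree `S` of `R` to its leaves. -/
def Valid (n : ℕ) (R S : CExpr c) (x : ℕ → ℤ) : Prop :=
  ∀ l, |x l| + (n * S.size : ℕ) ≤ (n * R.size : ℕ)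

theorem Valid.abs_le {n : ℕ} {R S : CExpr c} {x : ℕ → ℤ} (h : Valid n R S x) (l : ℕ) :
    |x l| ≤ (n * R.size : ℕ) := by
  have := h l
  omega

theorem Valid.of_size_le {n : ℕ} {R S S' : CExpr c} {x : ℕ → ℤ} (h : Valid n R S x)
    (hS : S'.size ≤ S.size) : Valid n R S' x := by
  intro l
  have h1 := h l
  have h2 : n * S'.size ≤ n * S.size := Nat.mul_le_mul_left n hS
  omega

theorem Valid.update {n : ℕ} {R S : CExpr c} {x : ℕ → ℤ} (h : Valid n R S x) (i j : ℕ) :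
    Valid n R S (Function.update x i (x j)) := by
  intro l
  by_cases hl : l = i
  · subst hl; simpa using h j
  · simpa [hl] using h l

/-- Digits of `γ` are at most `n`, so their difference is at most `n` in absolute value, and `i ≠ j`
lets at most one difference affect an entry. The join node itself contributes the `n` that is spent.
-/
theorem Valid.joinShift {n : ℕ} {R S : CExpr c} {i j : Fin c} {hij : i ≠ j} {x : ℕ → ℤ}
    (h : Valid n R (join i j hij S) x) (γ : ℕ) : Valid n R S (joinShift (n + 1) i j γ x) := by
  intro l
  have h1 := h l
  have h2 : n * (join i j hij S).size = n * S.size + n := rfl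
  have hd : ∀ k, γ / (n + 1) ^ k % (n + 1) ≤ n := fun k =>
    Nat.le_of_lt_succ (Nat.mod_lt _ n.succ_pos)
  have := hd i
  have := hd j
  have := hd (c + i)
  have := hd (c + j)
  have hij' : (i : ℕ) ≠ j := fun h => hij (Fin.ext h)
  rw [h2] at h1
  have h3 : |CExpr.joinShift (n + 1) i j γ x l| ≤ |x l| + n := by
    rw [CExpr.joinShift, add_assoc]
    refine (abs_add_le _ _).trans ?_
    gcongr
    rw [_root_.abs_le]
    split_ifs <;> omega
  push_cast at h1 ⊢
  linarith

end CExpr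

/-! ### Arithmetic notation for machine expressions -/

namespace RAM

instance : Add Expr := ⟨Expr.op .add⟩
instance : Sub Expr := ⟨Expr.op .sub⟩
instance : Mul Expr := ⟨Expr.op .mul⟩
instance : Div Expr := ⟨Expr.op .div⟩
instance : Mod Expr := ⟨Expr.op .mod⟩
instance (k : ℕ) : OfNat Expr k := ⟨Expr.const k⟩

namespace Expr

def lt (e f : Expr) : Expr := op .lt e f
def eq (e f : Expr) : Expr := op .eq e f

variable (s : State) (e f : Expr)

theorem eval_add : (e + f).eval s = e.eval s + f.eval s := rfl
theorem eval_sub : (e - f).eval s = e.eval s - f.eval s := rfl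
theorem eval_mul : (e * f).eval s = e.eval s * f.eval s := rfl
theorem eval_div : (e / f).eval s = e.eval s / f.eval s := rfl
theorem eval_mod : (e % f).eval s = e.eval s % f.eval s := rfl
theorem eval_zero : (0 : Expr).eval s = 0 := rfl
theorem eval_one : (1 : Expr).eval s = 1 := rfl
theorem eval_two : (2 : Expr).eval s = 2 := rfl
theorem eval_three : (3 : Expr).eval s = 3 := rfl
theorem eval_four : (4 : Expr).eval s = 4 := rfl
theorem eval_lt : (lt e f).eval s = if e.eval s < f.eval s then 1 else 0 := rfl
theorem eval_eq : (eq e f).eval s = if e.eval s = f.eval s then 1 else 0 := rfl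
theorem eval_mem : (mem e).eval s = s.mem (e.eval s) := rfl
theorem eval_reg (x : ℕ) : (reg x).eval s = s.reg x := rfl

theorem eval_lt_ne_zero : (lt e f).eval s ≠ 0 ↔ e.eval s < f.eval s := by
  rw [eval_lt]; split_ifs <;> simp_all

theorem eval_eq_ne_zero : (eq e f).eval s ≠ 0 ↔ e.eval s = f.eval s := by
  rw [eval_eq]; split_ifs <;> simp_all

theorem eval_lt_le_one : (lt e f).eval s ≤ 1 := by
  rw [eval_lt]; split_ifs <;> simp

end Expr

/-- Increment a register. -/
def Cmd.incr (x : ℕ) : Cmd := .assign x (Expr.reg x + 1)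

theorem Run.store_incr {Y w : ℕ} (hY : 2 ≤ Y) {s : State} (hs : s.Below Y) {a e : Expr} {x : ℕ}
    (hw : Y ^ (Cmd.seq (.store a e) (.incr x)).weight ≤ 2 ^ w) (he : e.eval s < Y)
    (hx : s.reg x + 1 < Y) :
    Run w (.seq (.store a e) (.incr x)) s (Cmd.seq (.store a e) (.incr x)).weight fun s' =>
      s'.Below Y ∧ s' = ⟨Function.update s.reg x (s.reg x + 1),
        Function.update s.mem (a.eval s) (e.eval s)⟩ := by
  have hle : ∀ {k : ℕ}, k ≤ (Cmd.seq (.store a e) (.incr x)).weight → Y ^ k ≤ 2 ^ w :=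
    fun h => (Nat.pow_le_pow_right (by omega) h).trans hw
  refine (Run.store hY hs (hle ?_) he).seq ?_
  · simp only [Cmd.weight]; omega
  · rintro _ ⟨h1, rfl⟩
    exact Run.assign hY h1 (hle (by simp only [Cmd.weight, Cmd.incr]; omega)) hx

theorem Run.assign_incr {Y w : ℕ} (hY : 2 ≤ Y) {s : State} (hs : s.Below Y) {e : Expr} {x y : ℕ}
    (hxy : x ≠ y) (hw : Y ^ (Cmd.seq (.assign y e) (.incr x)).weight ≤ 2 ^ w)
    (he : e.eval s < Y) (hx : s.reg x + 1 < Y) :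
    Run w (.seq (.assign y e) (.incr x)) s (Cmd.seq (.assign y e) (.incr x)).weight fun s' =>
      s'.Below Y ∧ s' = ⟨Function.update (Function.update s.reg y (e.eval s)) x (s.reg x + 1),
        s.mem⟩ := by
  have hle : ∀ {k : ℕ}, k ≤ (Cmd.seq (.assign y e) (.incr x)).weight → Y ^ k ≤ 2 ^ w :=
    fun h => (Nat.pow_le_pow_right (by omega) h).trans hw
  refine (Run.assign hY hs (hle ?_) he).seq ?_
  · simp only [Cmd.weight]; omega
  · rintro _ ⟨h1, rfl⟩
    have h2 : (Expr.reg x + 1).eval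
        ⟨Function.update s.reg y (e.eval s), s.mem⟩ = s.reg x + 1 := by
      simp [Expr.eval_add, Expr.eval_reg, Expr.eval_one, hxy]
    refine (Run.assign hY h1 (hle (by simp only [Cmd.weight, Cmd.incr]; omega)) ?_).mono le_rfl ?_
    · rw [h2]; exact hx
    · rintro _ ⟨h3, rfl⟩
      refine ⟨h3, ?_⟩
      rw [h2]

end RAM

namespace RAM

/-! ### The program

The memory contains the input, the powers of `n + 1` and of `2 * n * m + 1`, where `m` is the
number of nodes, the sizes of the subtrees, and the table of feasible entries. -/

open _root_.RAM.Expr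

def nE : Expr := mem 0
def cE : Expr := mem 1
def mE : Expr := mem 2
def baseE : Expr := nE + 1
def radixE : Expr := 2 * (nE * mE) + 1
-- The first address after the input. The adjacency matrix is skipped, since the expression
-- determines the graph.
def powersE : Expr := 3 + 3 * mE + nE * nE
-- The two lists of powers are interleaved: this one at even offsets, `radixPowE` at odd ones.
def basePowE (e : Expr) : Expr := mem (powersE + 2 * e)
def radixPowE (e : Expr) : Expr := mem (powersE + 1 + 2 * e)
def profilesE : Expr := basePowE (2 * cE)
def excessesE : Expr := radixPowE cE
def sizesE : Expr := powersE + 4 * cE + 2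
def sizeE (t : Expr) : Expr := mem (sizesE + t)
def tableE : Expr := sizesE + mE
def entryE (t γ ξ : Expr) : Expr := mem (tableE + ((t * profilesE + γ) * excessesE + ξ))
def kindE (t : Expr) : Expr := mem (3 + (3 * t + 0))
def fstE (t : Expr) : Expr := mem (3 + (3 * t + 1))
def sndE (t : Expr) : Expr := mem (3 + (3 * t + 2))
def baseDigitE (γ k : Expr) : Expr := γ / basePowE k % baseE
def radixDigitE (ξ k : Expr) : Expr := ξ / radixPowE k % radixE

/-- Compute the powers. -/
def powersCmd : Cmd :=
  .seq (.store powersE 1) <| .seq (.store (powersE + 1) 1) <|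
    .loop (lt (reg 1) (2 * cE)) <|
      .seq (.store (powersE + 2 * (reg 1 + 1)) (baseE * basePowE (reg 1))) <|
      .seq (.store (powersE + 1 + 2 * (reg 1 + 1)) (radixE * radixPowE (reg 1))) (.incr 1)

/-- Compute the sizes of the subtrees. -/
def sizesCmd : Cmd :=
  .loop (lt (reg 2) mE) <|
    .seq (.store (sizesE + reg 2) (1 + lt 0 (kindE (reg 2)) * sizeE (reg 2 - 1) +
      eq (kindE (reg 2)) 1 * sizeE (reg 2 - 1 - sizeE (reg 2 - 1)))) (.incr 2)

/-- Nonzero means true, sums are disjunctions and products conjunctions. Digits of `ξ` are shifted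
by `n * m`, so a comparison with that number reveals the sign. -/
def leafE (i γ ξ : Expr) : Expr :=
  eq γ (basePowE i) * lt (radixDigitE ξ i) (nE * mE + 1) +
    eq γ (basePowE (cE + i)) * lt (nE * mE) (radixDigitE ξ i + 1)

def unionE (t γ δ ξ : Expr) : Expr :=
  lt δ (γ + 1) * (entryE (t - 1 - sizeE (t - 1)) δ ξ * entryE (t - 1) (γ - δ) ξ)

def relabelE (t i j γ δ ξ : Expr) : Expr :=
  eq (γ + baseDigitE δ i * basePowE i + baseDigitE δ (cE + i) * basePowE (cE + i))
      (δ + baseDigitE δ i * basePowE j + baseDigitE δ (cE + i) * basePowE (cE + j)) *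
    entryE (t - 1) δ (ξ + radixDigitE ξ j * radixPowE i - radixDigitE ξ i * radixPowE i)

def joinE (t i j γ δ ξ : Expr) : Expr :=
  eq γ δ * entryE (t - 1) δ (ξ + baseDigitE δ (cE + j) * radixPowE i +
    baseDigitE δ (cE + i) * radixPowE j -
    (baseDigitE δ j * radixPowE i + baseDigitE δ i * radixPowE j))

/-- The tests of the kind select one summand; the others are evaluated too, possibly to meaningless
numbers, and multiplied by 0. -/
def hitE (t γ δ ξ : Expr) : Expr :=
  eq (kindE t) 0 * leafE (fstE t) γ ξ + eq (kindE t) 1 * unionE t γ δ ξ +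
    eq (kindE t) 2 * relabelE t (fstE t) (sndE t) γ δ ξ +
    eq (kindE t) 3 * joinE t (fstE t) (sndE t) γ δ ξ

/-- The number of the table entry that is treated. -/
def currentE : Expr := reg 3 / profilesE

/-- Compute the table. -/
def tableCmd : Cmd :=
  .loop (lt (reg 3) (mE * profilesE * excessesE * profilesE)) <|
    .seq (.store (tableE + currentE) (lt 0 (mem (tableE + currentE) +
      hitE (currentE / excessesE / profilesE) (currentE / excessesE % profilesE)
        (reg 3 % profilesE) (currentE % excessesE)))) (.incr 3)

/-- Search the table at the root for a profile that passes the test `g`. -/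
def answerCmd (g : Expr) : Cmd :=
  .loop (lt (reg 4) profilesE) <|
    .seq (.assign 0 (lt 0 (reg 0 + entryE (mE - 1) (reg 4) (excessesE / 2) * g))) (.incr 4)

def partitionCmd (g : Expr) : Cmd :=
  .seq powersCmd <| .seq sizesCmd <| .seq tableCmd (answerCmd g)

/-! ### The contents of the memory -/

variable {c : ℕ} (n : ℕ) (R : CExpr c)

def radix : ℕ := 2 * (n * R.size) + 1
def powersAddr : ℕ := 3 + 3 * R.size + n * n
def profiles (_ : CExpr c) : ℕ := (n + 1) ^ (2 * c)
def excesses : ℕ := radix n R ^ c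
-- Two powers are stored for each exponent from 0 to `2 * c`.
def sizesAddr : ℕ := powersAddr n R + 4 * c + 2
def tableAddr : ℕ := sizesAddr n R + R.size
def entry (t γ ξ : ℕ) : ℕ := (t * profiles n R + γ) * excesses n R + ξ

/-- A bound for all numbers that the program stores. -/
def wordBound : ℕ :=
  n + R.size + 2 * c + 6 + profiles n R + radix n R ^ (2 * c) +
    R.size * profiles n R * excesses n R * profiles n R

structure HasInput (s : State) : Prop where
  mem_zero : s.mem 0 = n
  mem_one : s.mem 1 = c
  mem_two : s.mem 2 = R.size
  mem_node : ∀ t < R.size, ∀ e < 3, s.mem (3 + (3 * t + e)) = (R.nodeAt t).head.getD e 0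

def HasPowers (N : ℕ) (s : State) : Prop :=
  ∀ i ≤ N, s.mem (powersAddr n R + 2 * i) = (n + 1) ^ i ∧
    s.mem (powersAddr n R + 1 + 2 * i) = radix n R ^ i

def HasSizes (N : ℕ) (s : State) : Prop :=
  ∀ t < N, s.mem (sizesAddr n R + t) = (R.nodeAt t).size

/-- The contents of the table after the first `N` pairs of an entry and a profile of a child have
been treated. -/
def HasTable (N : ℕ) (s : State) : Prop :=
  ∀ t < R.size, ∀ γ < profiles n R, ∀ x, CExpr.Valid n R (R.nodeAt t) x →
    (s.mem (tableAddr n R + entry n R t γ (CExpr.encode c (n * R.size) x)) ≠ 0 ↔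
      ∃ δ < profiles n R, entry n R t γ (CExpr.encode c (n * R.size) x) * profiles n R + δ < N ∧
        CExpr.Hit (n + 1) (R.nodeAt t) γ δ x)

variable {n R}

theorem HasInput.congr {s s' : State} (h : HasInput n R s)
    (hs : ∀ a < powersAddr n R, s'.mem a = s.mem a) : HasInput n R s' := by
  have h1 := R.size_pos
  unfold powersAddr at hs
  refine ⟨?_, ?_, ?_, fun t ht e he => ?_⟩
  · rw [hs _ (by omega), h.mem_zero]
  · rw [hs _ (by omega), h.mem_one]
  · rw [hs _ (by omega), h.mem_two]
  · rw [hs _ (by have := Nat.zero_le (n * n); omega), h.mem_node t ht e he]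

theorem HasPowers.congr {N : ℕ} (hN : N ≤ 2 * c) {s s' : State} (h : HasPowers n R N s)
    (hs : ∀ a < sizesAddr n R, s'.mem a = s.mem a) : HasPowers n R N s' := by
  unfold sizesAddr at hs
  intro i hi
  rw [hs _ (by omega), hs _ (by omega)]
  exact h i hi

theorem HasSizes.congr {s s' : State} (h : HasSizes n R R.size s)
    (hs : ∀ a < tableAddr n R, s'.mem a = s.mem a) : HasSizes n R R.size s' := by
  unfold tableAddr at hs
  intro i hi
  rw [hs _ (by omega)]
  exact h i hi

theorem powersAddr_lt_sizesAddr : powersAddr n R < sizesAddr n R := by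
  unfold sizesAddr; omega

theorem sizesAddr_le_tableAddr : sizesAddr n R ≤ tableAddr n R := by
  unfold tableAddr; omega

/-! ### Values of expressions -/

theorem HasInput.eval_n {s : State} (h : HasInput n R s) : nE.eval s = n := h.mem_zero
theorem HasInput.eval_c {s : State} (h : HasInput n R s) : cE.eval s = c := h.mem_one
theorem HasInput.eval_m {s : State} (h : HasInput n R s) : mE.eval s = R.size := h.mem_two

theorem HasInput.eval_base {s : State} (h : HasInput n R s) : baseE.eval s = n + 1 := by
  rw [baseE, eval_add, h.eval_n, eval_one]

theorem HasInput.eval_radix {s : State} (h : HasInput n R s) : radixE.eval s = radix n R := by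
  rw [radixE, eval_add, eval_mul, eval_mul, h.eval_n, h.eval_m, eval_one, eval_two, radix]

theorem HasInput.eval_powersAddr {s : State} (h : HasInput n R s) :
    powersE.eval s = powersAddr n R := by
  rw [powersE, eval_add, eval_add, eval_mul, eval_mul, h.eval_n, h.eval_m, eval_three, powersAddr]

theorem HasInput.eval_sizesAddr {s : State} (h : HasInput n R s) :
    sizesE.eval s = sizesAddr n R := by
  rw [sizesE, eval_add, eval_add, eval_mul, h.eval_powersAddr, h.eval_c, eval_four, eval_two,
    sizesAddr]

theorem HasInput.eval_tableAddr {s : State} (h : HasInput n R s) :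
    tableE.eval s = tableAddr n R := by
  rw [tableE, eval_add, h.eval_sizesAddr, h.eval_m, tableAddr]

theorem HasPowers.eval_basePow {N : ℕ} {s : State} (hp : HasPowers n R N s)
    (h : HasInput n R s) {e : Expr} (he : e.eval s ≤ N) :
    (basePowE e).eval s = (n + 1) ^ e.eval s := by
  rw [basePowE, eval_mem, eval_add, eval_mul, eval_two, h.eval_powersAddr, (hp _ he).1]

theorem HasPowers.eval_radixPow {N : ℕ} {s : State} (hp : HasPowers n R N s)
    (h : HasInput n R s) {e : Expr} (he : e.eval s ≤ N) :
    (radixPowE e).eval s = radix n R ^ e.eval s := by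
  rw [radixPowE, eval_mem, eval_add, eval_add, eval_mul, eval_one, eval_two, h.eval_powersAddr,
    (hp _ he).2]

theorem HasPowers.eval_profiles {s : State} (hp : HasPowers n R (2 * c) s)
    (h : HasInput n R s) : profilesE.eval s = profiles n R := by
  have hc : (2 * cE).eval s = 2 * c := by rw [eval_mul, eval_two, h.eval_c]
  rw [profilesE, hp.eval_basePow h hc.le, hc, profiles]

theorem HasPowers.eval_excesses {s : State} (hp : HasPowers n R (2 * c) s)
    (h : HasInput n R s) : excessesE.eval s = excesses n R := by
  rw [excessesE, hp.eval_radixPow h (by rw [h.eval_c]; omega), h.eval_c, excesses]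

theorem HasPowers.eval_entry {s : State} (hp : HasPowers n R (2 * c) s) (h : HasInput n R s)
    (t γ ξ : Expr) : (entryE t γ ξ).eval s =
      s.mem (tableAddr n R + entry n R (t.eval s) (γ.eval s) (ξ.eval s)) := by
  rw [entryE, eval_mem, eval_add, eval_add, eval_mul, eval_add, eval_mul, h.eval_tableAddr,
    hp.eval_profiles h, hp.eval_excesses h, entry]

theorem HasPowers.eval_baseDigit {s : State} (hp : HasPowers n R (2 * c) s)
    (h : HasInput n R s) {γ k : Expr} (hk : k.eval s ≤ 2 * c) :
    (baseDigitE γ k).eval s = γ.eval s / (n + 1) ^ k.eval s % (n + 1) := by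
  rw [baseDigitE, eval_mod, eval_div, hp.eval_basePow h hk, h.eval_base]

theorem HasPowers.eval_radixDigit {s : State} (hp : HasPowers n R (2 * c) s)
    (h : HasInput n R s) {ξ k : Expr} (hk : k.eval s ≤ 2 * c) :
    (radixDigitE ξ k).eval s = ξ.eval s / radix n R ^ k.eval s % radix n R := by
  rw [radixDigitE, eval_mod, eval_div, hp.eval_radixPow h hk, h.eval_radix]

theorem HasInput.eval_node {s : State} (h : HasInput n R s) {t : Expr} (ht : t.eval s < R.size) :
    (kindE t).eval s = (R.nodeAt (t.eval s)).head.getD 0 0 ∧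
    (fstE t).eval s = (R.nodeAt (t.eval s)).head.getD 1 0 ∧
    (sndE t).eval s = (R.nodeAt (t.eval s)).head.getD 2 0 :=
  ⟨h.mem_node _ ht 0 (by omega), h.mem_node _ ht 1 (by omega), h.mem_node _ ht 2 (by omega)⟩

theorem HasInput.eval_size {s : State} (h : HasInput n R s) (t : Expr) :
    (sizeE t).eval s = s.mem (sizesAddr n R + t.eval s) := by
  rw [sizeE, eval_mem, eval_add, h.eval_sizesAddr]

/-! ### The first two phases -/

theorem profiles_pos : 0 < profiles n R := by unfold profiles; positivity

theorem excesses_pos : 0 < excesses n R := by unfold excesses radix; positivity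

theorem two_le_wordBound : 2 ≤ wordBound n R := by unfold wordBound; omega

theorem run_powersCmd {w : ℕ} (hw : wordBound n R ^ powersCmd.weight ≤ 2 ^ w) {s : State}
    (hs : s.Below (wordBound n R)) (hi : HasInput n R s) (hreg : ∀ x, s.reg x = 0)
    (hmem : ∀ a, powersAddr n R ≤ a → s.mem a = 0) :
    Run w powersCmd s ((2 * c + 2) * powersCmd.weight) fun s' =>
      s'.Below (wordBound n R) ∧ HasInput n R s' ∧ (∀ x ≠ 1, s'.reg x = 0) ∧
      HasPowers n R (2 * c) s' ∧ ∀ a, sizesAddr n R ≤ a → s'.mem a = 0 := by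
  have hY := two_le_wordBound (n := n) (R := R)
  set Y := wordBound n R with hYdef
  have hle : ∀ {k : ℕ}, k ≤ powersCmd.weight → Y ^ k ≤ 2 ^ w :=
    fun h => (Nat.pow_le_pow_right (by omega) h).trans hw
  -- The invariant also keeps the memory above zero, because the table has to start empty.
  let I : ℕ → State → Prop := fun k s => s.Below Y ∧ HasInput n R s ∧ s.reg 1 = k ∧
    (∀ x ≠ 1, s.reg x = 0) ∧ HasPowers n R k s ∧ ∀ a, powersAddr n R + 2 * k + 2 ≤ a → s.mem a = 0
  have hguard : ∀ k s, I k s → ((lt (reg 1) (2 * cE)).eval s ≠ 0 ↔ k < 2 * c) := by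
    rintro k s ⟨-, h2, h3, -⟩
    rw [eval_lt_ne_zero, eval_reg, eval_mul, eval_two, h2.eval_c, h3]
  have hloop : ∀ s, I 0 s → Run w (.loop (lt (reg 1) (2 * cE)) <|
      .seq (.store (powersE + 2 * (reg 1 + 1)) (baseE * basePowE (reg 1))) <|
      .seq (.store (powersE + 1 + 2 * (reg 1 + 1)) (radixE * radixPowE (reg 1))) (.incr 1)) s
      ((2 * c + 1) * powersCmd.weight) (I (2 * c)) := by
    intro s h0
    refine (Run.loop hY (hle (by simp only [powersCmd, Cmd.weight]; omega)) I (2 * c)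
      (fun k s h => h.1) (fun s h => ?_) (fun k s hk h => (hguard k s h).2 hk) ?_ h0).mono
        (Nat.mul_le_mul_left _ (by simp only [powersCmd, Cmd.weight]; omega)) (fun _ h => h)
    · have := hguard _ s h
      simpa using this
    · rintro k s hk ⟨h1, h2, h3, h4, h5, h6⟩
      have hkp := h5 k le_rfl
      have hB : (n + 1) ^ (k + 1) < Y := by
        have : (n + 1) ^ (k + 1) ≤ profiles n R := Nat.pow_le_pow_right (by omega) (by omega)
        rw [hYdef, wordBound]; omega
      -- The common loop computes the powers of the radix up to `2 * c`, although only those up to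
      -- `c` are used; hence the corresponding term in `wordBound`.
      have hD : radix n R ^ (k + 1) < Y := by
        have : radix n R ^ (k + 1) ≤ radix n R ^ (2 * c) :=
          Nat.pow_le_pow_right (by unfold radix; omega) (by omega)
        rw [hYdef, wordBound]; omega
      have ev1 : (baseE * basePowE (reg 1)).eval s = (n + 1) ^ (k + 1) := by
        rw [eval_mul, h2.eval_base, h5.eval_basePow h2 (e := reg 1) h3.le, eval_reg, h3, pow_succ']
      have ea1 : (powersE + 2 * (reg 1 + 1)).eval s = powersAddr n R + 2 * (k + 1) := by
        rw [eval_add, eval_mul, eval_add, eval_reg, h3, h2.eval_powersAddr, eval_one, eval_two]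
      refine Run.seq (Run.store hY h1 (hle ?_) (by rw [ev1]; exact hB)) ?_
      · simp only [powersCmd, Cmd.weight]; omega
      rintro s' ⟨h1', hs'⟩
      rw [ev1, ea1] at hs'
      have hm : ∀ a, a ≠ powersAddr n R + 2 * (k + 1) → s'.mem a = s.mem a := by
        intro a ha; rw [hs']; simp [ha]
      have hr : s'.reg = s.reg := by rw [hs']
      have h2' : HasInput n R s' := h2.congr fun a ha => hm a (by omega)
      have h5' : HasPowers n R k s' := fun i hi => by
        rw [hm _ (by omega), hm _ (by omega)]; exact h5 i hi
      have ev2 : (radixE * radixPowE (reg 1)).eval s' = radix n R ^ (k + 1) := by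
        rw [eval_mul, h2'.eval_radix, h5'.eval_radixPow h2' (by rw [eval_reg, hr, h3]),
          eval_reg, hr, h3, pow_succ']
      have ea2 : (powersE + 1 + 2 * (reg 1 + 1)).eval s' = powersAddr n R + 1 + 2 * (k + 1) := by
        rw [eval_add, eval_mul, eval_add, eval_add, eval_reg, hr, h3, h2'.eval_powersAddr, eval_one,
          eval_two]
      refine (Run.store_incr hY h1' (hle ?_) (by rw [ev2]; exact hD) ?_).mono le_rfl ?_
      · simp only [powersCmd, Cmd.weight]; omega
      · rw [hr, h3, hYdef, wordBound]; omega
      rintro s'' ⟨h1'', hs''⟩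
      rw [ev2, ea2, hr, h3] at hs''
      have hm' : ∀ a, a ≠ powersAddr n R + 1 + 2 * (k + 1) → s''.mem a = s'.mem a := by
        intro a ha; rw [hs'']; simp [ha]
      refine ⟨h1'', h2'.congr fun a ha => hm' a (by omega), by rw [hs'']; simp, ?_, ?_, ?_⟩
      · intro x hx; rw [hs'']; simpa [hx] using h4 x hx
      · intro i hik
        rcases Nat.lt_or_ge i (k + 1) with h | h
        · rw [hm' _ (by omega), hm' _ (by omega)]; exact h5' i (by omega)
        · obtain rfl : i = k + 1 := by omega
          rw [hm' _ (by omega), hs'', hs']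
          simp
      · intro a ha
        rw [hm' _ (by omega), hm _ (by omega)]; exact h6 a (by omega)
  have ea1 : powersE.eval s = powersAddr n R := hi.eval_powersAddr
  have h1Y : 1 < Y := hY
  refine Run.mono (t := (Cmd.store powersE 1).weight + ((Cmd.store (powersE + 1) 1).weight +
    (2 * c + 1) * powersCmd.weight)) (Run.seq (Run.store hY hs (hle ?_) h1Y) ?_) ?_ (Q := _)
    (P := I (2 * c)) ?_
  · simp only [powersCmd, Cmd.weight]; omega
  · rintro s' ⟨h1', hs'⟩
    rw [ea1, eval_one] at hs'
    have hm : ∀ a, a ≠ powersAddr n R → s'.mem a = s.mem a := by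
      intro a ha; rw [hs']; simp [ha]
    have h2' : HasInput n R s' := hi.congr fun a ha => hm a (by omega)
    refine Run.seq (Run.store hY h1' (hle ?_) h1Y) ?_
    · simp only [powersCmd, Cmd.weight]; omega
    rintro s'' ⟨h1'', hs''⟩
    rw [eval_add, h2'.eval_powersAddr, eval_one] at hs''
    have hm' : ∀ a, a ≠ powersAddr n R + 1 → s''.mem a = s'.mem a := by
      intro a ha; rw [hs'']; simp [ha]
    have hr : s''.reg = s.reg := by rw [hs'', hs']
    refine hloop s'' ⟨h1'', h2'.congr fun a ha => hm' a (by omega), by rw [hr, hreg],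
      fun x _ => by rw [hr, hreg], fun i hi0 => ?_, fun a ha => ?_⟩
    · obtain rfl : i = 0 := by omega
      refine ⟨?_, ?_⟩
      · rw [hm' _ (by omega), hs']; simp
      · rw [hs'']; simp
    · rw [hm' _ (by omega), hm _ (by omega), hmem _ (by omega)]
  · have : (2 * c + 2) * powersCmd.weight =
        powersCmd.weight + (2 * c + 1) * powersCmd.weight := by ring
    rw [this]
    have : (Cmd.store powersE 1).weight + (Cmd.store (powersE + 1) 1).weight ≤
        powersCmd.weight := by simp only [powersCmd, Cmd.weight]; omega
    omega
  · rintro s' ⟨h1, h2, -, h4, h5, h6⟩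
    exact ⟨h1, h2, h4, h5, fun a ha => h6 a (by unfold sizesAddr at ha; omega)⟩

theorem run_sizesCmd {w : ℕ} (hw : wordBound n R ^ sizesCmd.weight ≤ 2 ^ w) {s : State}
    (hs : s.Below (wordBound n R)) (hi : HasInput n R s) (hreg : ∀ x ≠ 1, s.reg x = 0)
    (hp : HasPowers n R (2 * c) s) (hmem : ∀ a, sizesAddr n R ≤ a → s.mem a = 0) :
    Run w sizesCmd s ((R.size + 1) * sizesCmd.weight) fun s' =>
      s'.Below (wordBound n R) ∧ HasInput n R s' ∧ (∀ x ≠ 1, x ≠ 2 → s'.reg x = 0) ∧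
      HasPowers n R (2 * c) s' ∧ HasSizes n R R.size s' ∧
      ∀ a, tableAddr n R ≤ a → s'.mem a = 0 := by
  have hY := two_le_wordBound (n := n) (R := R)
  set Y := wordBound n R with hYdef
  have hle : ∀ {k : ℕ}, k ≤ sizesCmd.weight → Y ^ k ≤ 2 ^ w :=
    fun h => (Nat.pow_le_pow_right (by omega) h).trans hw
  let I : ℕ → State → Prop := fun k s => s.Below Y ∧ HasInput n R s ∧ s.reg 2 = k ∧
    (∀ x ≠ 1, x ≠ 2 → s.reg x = 0) ∧ HasPowers n R (2 * c) s ∧ HasSizes n R k s ∧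
    ∀ a, sizesAddr n R + k ≤ a → s.mem a = 0
  have hguard : ∀ k s, I k s → ((lt (reg 2) mE).eval s ≠ 0 ↔ k < R.size) := by
    rintro k s ⟨-, h2, h3, -⟩
    rw [eval_lt_ne_zero, eval_reg, h2.eval_m, h3]
  refine (Run.loop hY (hle le_rfl) I R.size (fun k s h => h.1) (fun s h => ?_)
    (fun k s hk h => (hguard k s h).2 hk) ?_ ?_).mono le_rfl ?_
  · have := hguard _ s h
    simpa using this
  · rintro k s hk ⟨h1, h2, h3, h4, h5, h6, h7⟩
    -- The size found at position `k - 1` locates the other child of a union. At `k = 0` the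
    -- subtractions truncate, but that node is a leaf and the factors vanish.
    have hev : (1 + lt 0 (kindE (reg 2)) * sizeE (reg 2 - 1) + eq (kindE (reg 2)) 1 *
        sizeE (reg 2 - 1 - sizeE (reg 2 - 1))).eval s = (R.nodeAt k).size := by
      have hch := R.childrenAt_nodeAt hk
      rw [eval_add, eval_add, eval_mul, eval_mul, h2.eval_size, h2.eval_size, eval_sub, eval_sub,
        h2.eval_size, eval_lt, eval_eq, (h2.eval_node (t := reg 2) (by rwa [eval_reg, h3])).1,
        eval_sub, eval_reg, h3, eval_one, eval_zero]
      cases hX : R.nodeAt k with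
      | leaf i => simp [CExpr.head, CExpr.size]
      | union S T =>
        rw [hX] at hch
        obtain ⟨ha, hb, hc⟩ := hch
        rw [h6 _ (by omega), hb, h6 _ (by omega), hc]
        simp [CExpr.head, CExpr.size]
        omega
      | relabel i j hij T =>
        rw [hX] at hch
        obtain ⟨ha, hb⟩ := hch
        rw [h6 _ (by omega), hb]
        simp [CExpr.head, CExpr.size]
        omega
      | join i j hij T =>
        rw [hX] at hch
        obtain ⟨ha, hb⟩ := hch
        rw [h6 _ (by omega), hb]
        simp [CExpr.head, CExpr.size]
        omega
    have hea : (sizesE + reg 2).eval s = sizesAddr n R + k := by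
      rw [eval_add, h2.eval_sizesAddr, eval_reg, h3]
    have hsz := R.size_nodeAt_le k
    refine (Run.store_incr hY h1 (hle ?_) ?_ ?_).mono le_rfl ?_
    · simp only [sizesCmd, Cmd.weight]; omega
    · rw [hev, hYdef, wordBound]; omega
    · rw [h3, hYdef, wordBound]; omega
    rintro s' ⟨h1', hs'⟩
    rw [hev, hea, h3] at hs'
    have hm : ∀ a, a ≠ sizesAddr n R + k → s'.mem a = s.mem a := by
      intro a ha; rw [hs']; simp [ha]
    have hlt := powersAddr_lt_sizesAddr (n := n) (R := R)
    refine ⟨h1', h2.congr fun a ha => hm a (by omega), by rw [hs']; simp, ?_,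
      h5.congr le_rfl fun a ha => hm a (by omega), ?_, fun a ha => ?_⟩
    · intro x hx hx'; rw [hs']; simpa [hx'] using h4 x hx hx'
    · intro t ht
      by_cases htk : t = k
      · subst htk; rw [hs']; simp
      · rw [hm _ (by omega)]; exact h6 t (by omega)
    · rw [hm _ (by omega)]; exact h7 a (by omega)
  · exact ⟨hs, hi, hreg 2 (by omega), fun x hx _ => hreg x hx, hp, fun t ht => by omega, hmem⟩
  · rintro s' ⟨h1, h2, -, h4, h5, h6, h7⟩
    exact ⟨h1, h2, h4, h5, h6, h7⟩

end RAM

namespace RAM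

open _root_.RAM.Expr

variable {c n : ℕ} {R : CExpr c}

/-! ### The table -/

theorem add_ne_zero_iff_or {a b : ℕ} : a + b ≠ 0 ↔ a ≠ 0 ∨ b ≠ 0 := by omega

theorem entry_decode {t γ ξ : ℕ} (hγ : γ < profiles n R) (hξ : ξ < excesses n R) :
    entry n R t γ ξ % excesses n R = ξ ∧
    entry n R t γ ξ / excesses n R % profiles n R = γ ∧
    entry n R t γ ξ / excesses n R / profiles n R = t := by
  have h1 : entry n R t γ ξ / excesses n R = t * profiles n R + γ := by
    rw [entry, mul_comm, Nat.mul_add_div excesses_pos, Nat.div_eq_of_lt hξ, add_zero]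
  refine ⟨?_, ?_, ?_⟩
  · rw [entry, mul_comm, Nat.mul_add_mod, Nat.mod_eq_of_lt hξ]
  · rw [h1, mul_comm, Nat.mul_add_mod, Nat.mod_eq_of_lt hγ]
  · rw [h1, mul_comm, Nat.mul_add_div profiles_pos, Nat.div_eq_of_lt hγ, add_zero]

/-- Entries are ordered by node first, so those of the children are complete before those of the
parent begin. -/
theorem entry_lt {t t' γ γ' ξ ξ' : ℕ} (ht : t' < t) (hγ : γ' < profiles n R)
    (hξ : ξ' < excesses n R) : entry n R t' γ' ξ' < entry n R t γ ξ := by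
  have h1 : (t' * profiles n R + γ' + 1) * excesses n R ≤
      (t * profiles n R + γ) * excesses n R := by
    refine Nat.mul_le_mul_right _ ?_
    have : (t' + 1) * profiles n R ≤ t * profiles n R := Nat.mul_le_mul_right _ ht
    rw [add_mul, one_mul] at this
    omega
  rw [add_mul, one_mul] at h1
  unfold entry
  omega

theorem entry_mul_add_lt {t γ ξ δ : ℕ} (ht : t < R.size) (hγ : γ < profiles n R)
    (hξ : ξ < excesses n R) (hδ : δ < profiles n R) :
    entry n R t γ ξ * profiles n R + δ <
      R.size * profiles n R * excesses n R * profiles n R := by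
  have h1 := entry_lt (γ := 0) (ξ := 0) ht hγ hξ
  have h2 : (entry n R t γ ξ + 1) * profiles n R ≤ entry n R R.size 0 0 * profiles n R :=
    Nat.mul_le_mul_right _ h1
  have h3 : entry n R R.size 0 0 = R.size * profiles n R * excesses n R := by simp [entry]
  rw [h3, add_mul, one_mul] at h2
  omega

variable (hcard : Fintype.card R.Vert = n) (hR : R.Irredundant)

-- Once all profiles of a child have been tried, the partial search in `HasTable` becomes the full
-- search of `feasible_iff_hit`.
include hcard hR in
theorem HasTable.ne_zero_iff {N : ℕ} {s : State} (h : HasTable n R N s) {t γ : ℕ}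
    (ht : t < R.size) (hγ : γ < profiles n R) {x : ℕ → ℤ} (hx : CExpr.Valid n R (R.nodeAt t) x)
    (hN : ∀ δ < profiles n R,
      entry n R t γ (CExpr.encode c (n * R.size) x) * profiles n R + δ < N) :
    s.mem (tableAddr n R + entry n R t γ (CExpr.encode c (n * R.size) x)) ≠ 0 ↔
      CExpr.Feasible (n + 1) (R.nodeAt t) γ x := by
  have := R.card_vert_nodeAt_le t
  rw [h t ht γ hγ x hx, CExpr.feasible_iff_hit (by omega) (hR.nodeAt t)]
  exact exists_congr fun δ => and_congr_right fun hδ => and_iff_right (hN δ hδ)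

theorem eval_leafE {s : State} (hi : HasInput n R s) (hp : HasPowers n R (2 * c) s) {i : Fin c}
    {x : ℕ → ℤ} (hx : ∀ l, |x l| ≤ (n * R.size : ℕ)) {eᵢ eγ eξ : Expr} (h₁ : eᵢ.eval s = i)
    (hξ : eξ.eval s = CExpr.encode c (n * R.size) x) :
    (leafE eᵢ eγ eξ).eval s ≠ 0 ↔ (eγ.eval s = (n + 1) ^ (i : ℕ) ∧ x i ≤ 0) ∨
      (eγ.eval s = (n + 1) ^ (c + i : ℕ) ∧ 0 ≤ x i) := by
  have hic := i.2
  have hci : (cE + eᵢ).eval s = c + i := by rw [eval_add, hi.eval_c, h₁]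
  have hM : (nE * mE).eval s = n * R.size := by rw [eval_mul, hi.eval_n, hi.eval_m]
  have hd : (radixDigitE eξ eᵢ).eval s = (x i + (n * R.size : ℕ)).toNat := by
    rw [hp.eval_radixDigit hi (by omega), h₁, hξ, radix, CExpr.encode_digit hx hic]
  rw [leafE, eval_add, eval_mul, eval_mul, add_ne_zero_iff_or, mul_ne_zero_iff, mul_ne_zero_iff,
    eval_eq_ne_zero, eval_eq_ne_zero, eval_lt_ne_zero, eval_lt_ne_zero,
    hp.eval_basePow hi (by omega), hp.eval_basePow hi (by omega), hci, eval_add, eval_add, eval_one,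
    hM, hd, h₁]
  have := _root_.abs_le.1 (hx i)
  have e1 : (x i + (n * R.size : ℕ)).toNat < n * R.size + 1 ↔ x i ≤ 0 := by omega
  have e2 : n * R.size < (x i + (n * R.size : ℕ)).toNat + 1 ↔ 0 ≤ x i := by omega
  rw [e1, e2]

include hcard hR in
theorem eval_hitE {s : State} (hi : HasInput n R s) (hp : HasPowers n R (2 * c) s)
    (hs : HasSizes n R R.size s) {N : ℕ} (htab : HasTable n R N s) {t γ δ : ℕ} (ht : t < R.size)
    (hγ : γ < profiles n R) (hδ : δ < profiles n R) {x : ℕ → ℤ}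
    (hx : CExpr.Valid n R (R.nodeAt t) x)
    (hN : entry n R t γ (CExpr.encode c (n * R.size) x) * profiles n R ≤ N)
    {et eγ eδ eξ : Expr} (h₁ : et.eval s = t) (h₂ : eγ.eval s = γ) (h₃ : eδ.eval s = δ)
    (h₄ : eξ.eval s = CExpr.encode c (n * R.size) x) :
    (hitE et eγ eδ eξ).eval s ≠ 0 ↔ CExpr.Hit (n + 1) (R.nodeAt t) γ δ x := by
  obtain ⟨hk, hf, hsn⟩ := hi.eval_node (t := et) (by rwa [h₁])
  rw [h₁] at hk hf hsn
  have hch := R.childrenAt_nodeAt ht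
  -- By `hN` the loop has reached the entry under consideration, so all entries of earlier nodes are
  -- final and may be read as `Feasible`.
  have htab' : ∀ t' < t, ∀ γ' < profiles n R, ∀ x', CExpr.Valid n R (R.nodeAt t') x' →
      (s.mem (tableAddr n R + entry n R t' γ' (CExpr.encode c (n * R.size) x')) ≠ 0 ↔
        CExpr.Feasible (n + 1) (R.nodeAt t') γ' x') := by
    intro t' ht' γ' hγ' x' hx'
    refine htab.ne_zero_iff hcard hR (by omega) hγ' hx' fun δ' hδ' => ?_
    have h1 := entry_lt (γ := γ) (ξ := CExpr.encode c (n * R.size) x) ht' hγ'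
      (CExpr.encode_lt hx'.abs_le)
    have h2 := Nat.mul_le_mul_right (profiles n R) (Nat.succ_le_of_lt h1)
    rw [Nat.succ_mul] at h2
    omega
  rw [hitE, eval_add, eval_add, eval_add, eval_mul, eval_mul, eval_mul, eval_mul,
    add_ne_zero_iff_or, add_ne_zero_iff_or, add_ne_zero_iff_or, mul_ne_zero_iff, mul_ne_zero_iff,
    mul_ne_zero_iff, mul_ne_zero_iff, eval_eq_ne_zero, eval_eq_ne_zero, eval_eq_ne_zero,
    eval_eq_ne_zero, hk, eval_zero, eval_one, eval_two, eval_three]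
  have ht1 : (et - 1).eval s = t - 1 := by rw [eval_sub, h₁, eval_one]
  have hxM := hx.abs_le
  have hdig : ∀ {e : Expr} {k : ℕ}, e.eval s = k → k < 2 * c →
      (baseDigitE eδ e).eval s = δ / (n + 1) ^ k % (n + 1) := fun he hkc => by
    rw [hp.eval_baseDigit hi (by omega), he, h₃]
  have hrdig : ∀ {e : Expr} {k : ℕ}, e.eval s = k → k < c →
      (radixDigitE eξ e).eval s = (x k + (n * R.size : ℕ)).toNat := fun he hkc => by
    rw [hp.eval_radixDigit hi (by omega), he, h₄, radix, CExpr.encode_digit hxM hkc]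
  have hbp : ∀ {e : Expr} {k : ℕ}, e.eval s = k → k < 2 * c →
      (basePowE e).eval s = (n + 1) ^ k := fun he hkc => by
    rw [hp.eval_basePow hi (by omega), he]
  have hrp : ∀ {e : Expr} {k : ℕ}, e.eval s = k → k < c →
      (radixPowE e).eval s = (2 * (n * R.size) + 1) ^ k := fun he hkc => by
    rw [hp.eval_radixPow hi (by omega), he, radix]
  cases hX : R.nodeAt t with
  | leaf i =>
    rw [hX] at hf
    have := eval_leafE hi hp hxM (eγ := eγ) hf h₄
    rw [h₂] at this
    simpa [CExpr.head, CExpr.Hit] using this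
  | union S T =>
    rw [hX] at hch hx
    obtain ⟨ha, hb, hc⟩ := hch
    have hz : (et - 1 - sizeE (et - 1)).eval s = t - 1 - T.size := by
      rw [eval_sub, hi.eval_size, ht1, hs _ (by omega), hb]
    have hS := htab' (t - 1 - T.size) (by omega) δ hδ x
      (by rw [hc]; exact hx.of_size_le (by simp only [CExpr.size]; omega))
    have hT := htab' (t - 1) (by omega) (γ - δ) (by omega) x
      (by rw [hb]; exact hx.of_size_le (by simp only [CExpr.size]; omega))
    rw [hc] at hS
    rw [hb] at hT
    have : (unionE et eγ eδ eξ).eval s ≠ 0 ↔ CExpr.Hit (n + 1) (S.union T) γ δ x := by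
      rw [unionE, eval_mul, eval_mul, mul_ne_zero_iff, mul_ne_zero_iff, hp.eval_entry hi,
        hp.eval_entry hi, hz, ht1, eval_lt_ne_zero, eval_add, eval_sub, eval_one, h₂, h₃, h₄, hS,
        hT, Nat.lt_succ_iff, CExpr.Hit]
    simpa [CExpr.head] using this
  | relabel i j hij T =>
    rw [hX] at hch hx hf hsn
    obtain ⟨ha, hb⟩ := hch
    have hf' : (fstE et).eval s = i := hf
    have hsn' : (sndE et).eval s = j := hsn
    have hci : (cE + fstE et).eval s = c + i := by rw [eval_add, hi.eval_c, hf']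
    have hcj : (cE + sndE et).eval s = c + j := by rw [eval_add, hi.eval_c, hsn']
    have hic := i.2
    have hjc := j.2
    have hT := htab' (t - 1) (by omega) δ hδ (Function.update x i (x j))
      (by rw [hb]; exact (hx.of_size_le (by simp only [CExpr.size]; omega)).update i j)
    rw [hb, CExpr.encode_update x j hic] at hT
    have : (relabelE et (fstE et) (sndE et) eγ eδ eξ).eval s ≠ 0 ↔
        CExpr.Hit (n + 1) (CExpr.relabel i j hij T) γ δ x := by
      rw [relabelE, eval_mul, mul_ne_zero_iff, eval_eq_ne_zero, hp.eval_entry hi, ht1]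
      simp only [eval_add, eval_sub, eval_mul]
      rw [hdig hf' (by omega), hdig hci (by omega), hbp hf' (by omega), hbp hci (by omega),
        hbp hsn' (by omega), hbp hcj (by omega), hrdig hf' hic, hrdig hsn' hjc, hrp hf' hic, h₂, h₃,
        h₄, hT, CExpr.Hit]
    simpa [CExpr.head] using this
  | join i j hij T =>
    rw [hX] at hch hx hf hsn
    obtain ⟨ha, hb⟩ := hch
    have hf' : (fstE et).eval s = i := hf
    have hsn' : (sndE et).eval s = j := hsn
    have hci : (cE + fstE et).eval s = c + i := by rw [eval_add, hi.eval_c, hf']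
    have hcj : (cE + sndE et).eval s = c + j := by rw [eval_add, hi.eval_c, hsn']
    have hic := i.2
    have hjc := j.2
    have hT := htab' (t - 1) (by omega) δ hδ (CExpr.joinShift (n + 1) i j δ x)
      (by rw [hb]; exact hx.joinShift δ)
    rw [hb, CExpr.encode_joinShift hxM (hx.joinShift δ).abs_le] at hT
    have : (joinE et (fstE et) (sndE et) eγ eδ eξ).eval s ≠ 0 ↔
        CExpr.Hit (n + 1) (CExpr.join i j hij T) γ δ x := by
      rw [joinE, eval_mul, mul_ne_zero_iff, eval_eq_ne_zero, hp.eval_entry hi, ht1]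
      simp only [eval_add, eval_sub, eval_mul]
      rw [hdig hf' (by omega), hdig hci (by omega), hdig hsn' (by omega), hdig hcj (by omega),
        hrp hf' hic, hrp hsn' hjc, h₂, h₃, h₄, hT, CExpr.Hit]
    simpa [CExpr.head] using this

-- The loop counter is the entry number times the number of profiles plus `δ`. Each cell accumulates
-- a disjunction over `δ`.
include hcard hR in
theorem run_tableCmd {w : ℕ} (hw : wordBound n R ^ tableCmd.weight ≤ 2 ^ w) {s : State}
    (hs : s.Below (wordBound n R)) (hi : HasInput n R s) (hreg : ∀ x ≠ 1, x ≠ 2 → s.reg x = 0)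
    (hp : HasPowers n R (2 * c) s) (hsz : HasSizes n R R.size s)
    (hmem : ∀ a, tableAddr n R ≤ a → s.mem a = 0) :
    Run w tableCmd s ((R.size * profiles n R * excesses n R * profiles n R + 1) *
      tableCmd.weight) fun s' =>
      s'.Below (wordBound n R) ∧ HasInput n R s' ∧ s'.reg 0 = 0 ∧ s'.reg 4 = 0 ∧
      HasPowers n R (2 * c) s' ∧
      HasTable n R (R.size * profiles n R * excesses n R * profiles n R) s' := by
  have hY := two_le_wordBound (n := n) (R := R)
  set Y := wordBound n R with hYdef
  set total := R.size * profiles n R * excesses n R * profiles n R with htotal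
  have hle : ∀ {k : ℕ}, k ≤ tableCmd.weight → Y ^ k ≤ 2 ^ w :=
    fun h => (Nat.pow_le_pow_right (by omega) h).trans hw
  let I : ℕ → State → Prop := fun k s => s.Below Y ∧ HasInput n R s ∧ s.reg 3 = k ∧
    s.reg 0 = 0 ∧ s.reg 4 = 0 ∧ HasPowers n R (2 * c) s ∧ HasSizes n R R.size s ∧
    HasTable n R k s
  have hguard : ∀ k s, I k s →
      ((lt (reg 3) (mE * profilesE * excessesE * profilesE)).eval s ≠ 0 ↔ k < total) := by
    rintro k s ⟨-, h2, h3, -, -, h4, -⟩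
    rw [eval_lt_ne_zero, eval_reg, eval_mul, eval_mul, eval_mul, h2.eval_m, h3, h4.eval_profiles h2,
      h4.eval_excesses h2]
  refine (Run.loop hY (hle le_rfl) I total (fun k s h => h.1) (fun s h => ?_)
    (fun k s hk h => (hguard k s h).2 hk) ?_ ?_).mono le_rfl ?_
  · have := hguard _ s h
    simpa using this
  · rintro k s hk ⟨h1, h2, h3, h4, h5, h6, h7, h8⟩
    have hcur : currentE.eval s = k / profiles n R := by
      rw [currentE, eval_div, h6.eval_profiles h2, eval_reg, h3]
    set v := (lt 0 (mem (tableE + currentE) + hitE (currentE / excessesE / profilesE)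
      (currentE / excessesE % profilesE) (reg 3 % profilesE) (currentE % excessesE))).eval s with hv
    have hea : (tableE + currentE).eval s = tableAddr n R + k / profiles n R := by
      rw [eval_add, h2.eval_tableAddr, hcur]
    refine (Run.store_incr hY h1 (hle ?_) ((eval_lt_le_one s _ _).trans_lt hY) ?_).mono le_rfl ?_
    · simp only [tableCmd, Cmd.weight]; omega
    · rw [h3, hYdef, wordBound]; omega
    rintro s' ⟨h1', hs'⟩
    rw [← hv, hea, h3] at hs'
    have hm : ∀ a, a ≠ tableAddr n R + k / profiles n R → s'.mem a = s.mem a := by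
      intro a ha; rw [hs']; simp [ha]
    have hlt := powersAddr_lt_sizesAddr (n := n) (R := R)
    have hlt' := sizesAddr_le_tableAddr (n := n) (R := R)
    refine ⟨h1', h2.congr fun a ha => hm a (by omega), by rw [hs']; simp,
      by rw [hs']; simpa using h4,
      by rw [hs']; simpa using h5, h6.congr le_rfl fun a ha => hm a (by omega),
      h7.congr fun a ha => hm a (by omega), ?_⟩
    intro t ht γ hγ x hx
    have hξ : CExpr.encode c (n * R.size) x < excesses n R := CExpr.encode_lt hx.abs_le
    have hold := h8 t ht γ hγ x hx
    set q := entry n R t γ (CExpr.encode c (n * R.size) x) with hq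
    have hdm := Nat.div_add_mod k (profiles n R)
    have hmod := Nat.mod_lt k (profiles_pos (n := n) (R := R))
    -- In the current cell the pair number `k` joins the search; for any other entry no pair has
    -- this number, and the cell is untouched.
    by_cases hqk : q = k / profiles n R
    · have hval : s'.mem (tableAddr n R + q) = v := by rw [hs', hqk]; simp
      obtain ⟨hd1, hd2, hd3⟩ := entry_decode (t := t) hγ hξ
      rw [← hq, hqk] at hd1 hd2 hd3
      have hk' : q * profiles n R + k % profiles n R = k := by rw [hqk, mul_comm]; exact hdm
      have hhit := eval_hitE hcard hR h2 h6 h7 h8 ht hγ hmod hx (by rw [← hq]; omega)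
        (et := currentE / excessesE / profilesE) (eγ := currentE / excessesE % profilesE)
        (eδ := reg 3 % profilesE) (eξ := currentE % excessesE)
        (by rw [eval_div, eval_div, hcur, h6.eval_profiles h2, h6.eval_excesses h2, hd3])
        (by rw [eval_mod, eval_div, hcur, h6.eval_profiles h2, h6.eval_excesses h2, hd2])
        (by rw [eval_mod, h6.eval_profiles h2, eval_reg, h3])
        (by rw [eval_mod, hcur, h6.eval_excesses h2, hd1])
      rw [hval, hv, eval_lt_ne_zero, eval_zero, eval_add, eval_mem, hea, ← hqk, Nat.pos_iff_ne_zero,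
        add_ne_zero_iff_or, hold, hhit]
      constructor
      · rintro (⟨δ, hδ, hδk, hδh⟩ | h)
        · exact ⟨δ, hδ, by omega, hδh⟩
        · exact ⟨_, hmod, by omega, h⟩
      · rintro ⟨δ, hδ, hδk, hδh⟩
        by_cases hδ' : δ = k % profiles n R
        · exact .inr (hδ' ▸ hδh)
        · exact .inl ⟨δ, hδ, by omega, hδh⟩
    · rw [hm _ (by omega), hold]
      refine exists_congr fun δ => and_congr_right fun hδ => and_congr_left fun _ => ?_
      have : q * profiles n R + δ ≠ k := by
        intro h
        apply hqk
        rw [← h, mul_comm, Nat.mul_add_div profiles_pos, Nat.div_eq_of_lt hδ, add_zero]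
      omega
  · refine ⟨hs, hi, hreg 3 (by omega) (by omega), hreg 0 (by omega) (by omega),
      hreg 4 (by omega) (by omega), hp, hsz, fun t ht γ hγ x hx => ?_⟩
    rw [hmem _ (by omega)]
    simp
  · rintro s' ⟨h1, h2, -, h3, h4, h5, -, h6⟩
    exact ⟨h1, h2, h3, h4, h5, h6⟩

/-! ### The answer -/

-- The memory no longer changes, so every round reads the finished table; register 0 accumulates the
-- disjunction over `γ`.
include hcard hR in
theorem run_answerCmd {w : ℕ} {g : Expr} (hw : wordBound n R ^ (answerCmd g).weight ≤ 2 ^ w)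
    {good : ℕ → Prop}
    (hg : ∀ s, HasInput n R s → HasPowers n R (2 * c) s → (g.eval s ≠ 0 ↔ good (s.reg 4)))
    {s : State} (hs : s.Below (wordBound n R)) (hi : HasInput n R s) (h0 : s.reg 0 = 0)
    (h4 : s.reg 4 = 0) (hp : HasPowers n R (2 * c) s)
    (htab : HasTable n R (R.size * profiles n R * excesses n R * profiles n R) s) :
    Run w (answerCmd g) s ((profiles n R + 1) * (answerCmd g).weight) fun s' =>
      ((∃ γ < profiles n R, CExpr.Feasible (n + 1) R γ 0 ∧ good γ) → s'.reg 0 = 1) ∧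
      ((¬ ∃ γ < profiles n R, CExpr.Feasible (n + 1) R γ 0 ∧ good γ) → s'.reg 0 = 0) := by
  have hY := two_le_wordBound (n := n) (R := R)
  set Y := wordBound n R with hYdef
  have hle : ∀ {k : ℕ}, k ≤ (answerCmd g).weight → Y ^ k ≤ 2 ^ w :=
    fun h => (Nat.pow_le_pow_right (by omega) h).trans hw
  have hfeas : ∀ γ < profiles n R,
      (s.mem (tableAddr n R + entry n R (R.size - 1) γ (excesses n R / 2)) ≠ 0 ↔
        CExpr.Feasible (n + 1) R γ 0) := by
    intro γ hγ
    have hpos := R.size_pos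
    -- At the root the bound in `Valid` is attained, and it leaves room for the zero vector only.
    have hx : CExpr.Valid n R (R.nodeAt (R.size - 1)) 0 := by
      rw [CExpr.nodeAt_last]
      intro l
      simp
    have := htab.ne_zero_iff hcard hR (t := R.size - 1) (by omega) hγ hx fun δ hδ =>
      entry_mul_add_lt (by omega) hγ (CExpr.encode_lt hx.abs_le) hδ
    rwa [CExpr.nodeAt_last, CExpr.encode_zero] at this
  let I : ℕ → State → Prop := fun k s' => s'.Below Y ∧ s'.mem = s.mem ∧ s'.reg 4 = k ∧
    s'.reg 0 ≤ 1 ∧ (s'.reg 0 ≠ 0 ↔ ∃ γ < k, CExpr.Feasible (n + 1) R γ 0 ∧ good γ)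
  have hii : ∀ {s' : State}, s'.mem = s.mem → HasInput n R s' := fun h =>
    hi.congr fun a _ => by rw [h]
  have hpp : ∀ {s' : State}, s'.mem = s.mem → HasPowers n R (2 * c) s' := fun h =>
    hp.congr le_rfl fun a _ => by rw [h]
  have hguard : ∀ k s, I k s → ((lt (reg 4) profilesE).eval s ≠ 0 ↔ k < profiles n R) := by
    rintro k s' ⟨-, h2, h3, -⟩
    rw [eval_lt_ne_zero, eval_reg, h3, (hpp h2).eval_profiles (hii h2)]
  refine (Run.loop hY (hle le_rfl) I (profiles n R) (fun k s h => h.1) (fun s h => ?_)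
    (fun k s hk h => (hguard k s h).2 hk) ?_ ?_).mono le_rfl ?_
  · have := hguard _ s h
    simpa using this
  · rintro k s' hk ⟨h1, h2, h3, h5, h6⟩
    have hi' := hii h2
    have hp' := hpp h2
    set v := (lt 0 (reg 0 + entryE (mE - 1) (reg 4) (excessesE / 2) * g)).eval s' with hv
    have hvv : v ≠ 0 ↔ ∃ γ < k + 1, CExpr.Feasible (n + 1) R γ 0 ∧ good γ := by
      rw [hv, eval_lt_ne_zero, eval_zero, Nat.pos_iff_ne_zero, eval_add, add_ne_zero_iff_or,
        eval_mul, mul_ne_zero_iff, hg s' hi' hp', hp'.eval_entry hi', eval_sub, hi'.eval_m,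
        eval_div, hp'.eval_excesses hi', eval_one, eval_two, eval_reg, eval_reg, h2, h6, h3,
        hfeas k hk]
      constructor
      · rintro (⟨γ, hγ, h⟩ | h)
        · exact ⟨γ, by omega, h⟩
        · exact ⟨k, by omega, h⟩
      · rintro ⟨γ, hγ, h⟩
        rcases Nat.lt_succ_iff_lt_or_eq.1 hγ with h' | rfl
        · exact .inl ⟨γ, h', h⟩
        · exact .inr h
    refine (Run.assign_incr hY h1 (by omega) (hle ?_) ((eval_lt_le_one s' _ _).trans_lt hY)
      ?_).mono le_rfl ?_
    · simp only [answerCmd, Cmd.weight]; omega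
    · rw [h3, hYdef, wordBound]; omega
    rintro s'' ⟨h1'', hs''⟩
    rw [← hv, h3] at hs''
    have h0'' : s''.reg 0 = v := by rw [hs'']; simp
    exact ⟨h1'', by rw [hs'', h2], by rw [hs'']; simp, by rw [h0'']; exact eval_lt_le_one s' _ _,
      by rw [h0'', hvv]⟩
  · exact ⟨hs, rfl, h4, by omega, by simp [h0]⟩
  · rintro s' ⟨-, -, -, h5, h6⟩
    refine ⟨fun h => ?_, fun h => ?_⟩
    · have := h6.2 h
      omega
    · by_contra h'
      exact h (h6.1 h')

/-! ### From the initial memory to the decision -/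

theorem below_initial {G : SimpleGraph (Fin n)} :
    (initial (SatisfactoryPartition.inputCode G R)).Below (wordBound n R) := by
  have hpos := profiles_pos (n := n) (R := R)
  refine ⟨fun x => ?_, fun a => ?_⟩
  · have := two_le_wordBound (n := n) (R := R)
    show 0 < _
    omega
  · refine (SatisfactoryPartition.inputCode_lt G R a).trans_le ?_
    unfold wordBound
    omega

theorem hasInput_initial {G : SimpleGraph (Fin n)} :
    HasInput n R (initial (SatisfactoryPartition.inputCode G R)) := by
  obtain ⟨h1, h2, h3, h4⟩ := SatisfactoryPartition.inputCode_getD G R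
  exact ⟨h1, h2, h3, h4⟩

theorem initial_eq_zero {G : SimpleGraph (Fin n)} {a : ℕ} (ha : powersAddr n R ≤ a) :
    (initial (SatisfactoryPartition.inputCode G R)).mem a = 0 :=
  List.getD_eq_default _ _ (by rw [SatisfactoryPartition.inputCode_length]; exact ha)

/-- A bound for the number of rounds of all loops together. -/
def rounds (n : ℕ) (R : CExpr c) : ℕ :=
  (2 * c + 2) + (R.size + 1) +
    (R.size * profiles n R * excesses n R * profiles n R + 1) + (profiles n R + 1)

include hcard hR in
theorem decides_partitionCmd {w : ℕ} {g : Expr} {good : ℕ → Prop}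
    (hw : wordBound n R ^ (partitionCmd g).weight ≤ 2 ^ w) (G : SimpleGraph (Fin n))
    (hg : ∀ s, HasInput n R s → HasPowers n R (2 * c) s → (g.eval s ≠ 0 ↔ good (s.reg 4))) :
    Decides w (partitionCmd g) (SatisfactoryPartition.inputCode G R)
      (rounds n R * (partitionCmd g).weight)
      (∃ γ < profiles n R, CExpr.Feasible (n + 1) R γ 0 ∧ good γ) := by
  have hle : ∀ {k : ℕ}, k ≤ (partitionCmd g).weight → wordBound n R ^ k ≤ 2 ^ w :=
    fun h => (Nat.pow_le_pow_right
      (by have := two_le_wordBound (n := n) (R := R); omega) h).trans hw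
  have hweight : (partitionCmd g).weight = powersCmd.weight + (sizesCmd.weight +
    (tableCmd.weight + (answerCmd g).weight)) := rfl
  refine Run.mono (t := (2 * c + 2) * powersCmd.weight + ((R.size + 1) * sizesCmd.weight +
    ((R.size * profiles n R * excesses n R * profiles n R + 1) * tableCmd.weight +
    (profiles n R + 1) * (answerCmd g).weight)))
    (Run.seq (run_powersCmd (hle (by omega)) below_initial hasInput_initial
    (fun _ => rfl) fun a ha => initial_eq_zero ha) ?_) ?_ fun s' hs' => hs'
  · rintro s1 ⟨h1, h2, h3, h4, h5⟩
    refine Run.seq (run_sizesCmd (hle (by omega)) h1 h2 h3 h4 h5) ?_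
    rintro s2 ⟨h1, h2, h3, h4, h5, h6⟩
    refine Run.seq (run_tableCmd hcard hR (hle (by omega)) h1 h2 h3 h4 h5 h6) ?_
    rintro s3 ⟨h1, h2, h3, h4, h5, h6⟩
    exact run_answerCmd hcard hR (hle (by omega)) hg h1 h2 h3 h4 h5 h6
  · have hsum : rounds n R * (partitionCmd g).weight = (2 * c + 2) * (partitionCmd g).weight +
        ((R.size + 1) * (partitionCmd g).weight +
        ((R.size * profiles n R * excesses n R * profiles n R + 1) * (partitionCmd g).weight +
        (profiles n R + 1) * (partitionCmd g).weight)) := by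
      rw [rounds]; ring
    rw [hsum]
    gcongr <;> omega

/-! ### The bounds -/

/-- The constant in the polynomial bounds. -/
def boundConst (c A : ℕ) : ℕ :=
  20 + 4 * c + 4 * A + 8 * 2 ^ (2 * c) + (3 * A) ^ (2 * c) +
    A * 2 ^ (2 * c) * (3 * A) ^ c * 2 ^ (2 * c)

/-- The table loop dominates, with one factor for the nodes and three factors of degree `2 * c`. The
total `6 * c + 1` is at most `8 * c` because `c ≥ 1`. -/
theorem wordBound_add_rounds_le {A : ℕ} (hn : 1 ≤ n) (hc : 1 ≤ c) (hA : R.size ≤ A * n) :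
    wordBound n R ≤ boundConst c A * n ^ (8 * c) ∧ rounds n R ≤ boundConst c A * n ^ (8 * c) := by
  have hpow : ∀ {k : ℕ}, k ≤ 8 * c → n ^ k ≤ n ^ (8 * c) := fun h => Nat.pow_le_pow_right hn h
  set P := n ^ (8 * c) with hP
  have h1P : 1 ≤ P := Nat.one_le_pow _ _ hn
  have hnP : n ≤ P := by simpa using hpow (k := 1) (by omega)
  have hsize := R.size_pos
  -- A tree has a node, which rules out `A = 0`; this absorbs the `+ 1` in the radix below.
  have hA1 : 1 ≤ A := by
    rcases Nat.eq_zero_or_pos A with rfl | h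
    · omega
    · exact h
  have hsP : R.size ≤ A * P := hA.trans (Nat.mul_le_mul_left _ hnP)
  have hprof : profiles n R ≤ 2 ^ (2 * c) * n ^ (2 * c) := by
    rw [profiles, ← mul_pow]
    exact Nat.pow_le_pow_left (by omega) _
  have hrad : radix n R ≤ 3 * A * n ^ 2 := by
    have h1 : n * R.size ≤ n * (A * n) := Nat.mul_le_mul_left _ hA
    have h2 : 1 ≤ n * (A * n) := Nat.mul_pos hn (Nat.mul_pos hA1 hn)
    have h3 : 3 * A * n ^ 2 = 3 * (n * (A * n)) := by ring
    rw [radix, h3]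
    omega
  have hrad2 : radix n R ^ (2 * c) ≤ (3 * A) ^ (2 * c) * P := by
    calc radix n R ^ (2 * c) ≤ (3 * A * n ^ 2) ^ (2 * c) := Nat.pow_le_pow_left hrad _
      _ = (3 * A) ^ (2 * c) * n ^ (4 * c) := by rw [mul_pow, ← pow_mul]; congr 2; ring
      _ ≤ (3 * A) ^ (2 * c) * P := Nat.mul_le_mul_left _ (hpow (by omega))
  have hexc : excesses n R ≤ (3 * A) ^ c * n ^ (2 * c) := by
    calc excesses n R ≤ (3 * A * n ^ 2) ^ c := Nat.pow_le_pow_left hrad _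
      _ = (3 * A) ^ c * n ^ (2 * c) := by rw [mul_pow, ← pow_mul]
  have htot : R.size * profiles n R * excesses n R * profiles n R ≤
      A * 2 ^ (2 * c) * (3 * A) ^ c * 2 ^ (2 * c) * P := by
    calc R.size * profiles n R * excesses n R * profiles n R
        ≤ (A * n) * (2 ^ (2 * c) * n ^ (2 * c)) * ((3 * A) ^ c * n ^ (2 * c)) *
          (2 ^ (2 * c) * n ^ (2 * c)) := by gcongr
      _ = A * 2 ^ (2 * c) * (3 * A) ^ c * 2 ^ (2 * c) * n ^ (2 * c + 2 * c + 2 * c + 1) := by ring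
      _ ≤ _ := Nat.mul_le_mul_left _ (hpow (by omega))
  have hprofP : profiles n R ≤ 2 ^ (2 * c) * P :=
    hprof.trans (Nat.mul_le_mul_left _ (hpow (by omega)))
  have hcP : c ≤ c * P := Nat.le_mul_of_pos_right _ h1P
  have hexp : boundConst c A * P = 20 * P + 4 * (c * P) + 4 * (A * P) + 8 * (2 ^ (2 * c) * P) +
      (3 * A) ^ (2 * c) * P + A * 2 ^ (2 * c) * (3 * A) ^ c * 2 ^ (2 * c) * P := by
    rw [boundConst]; ring
  rw [hexp, wordBound, rounds]
  constructor <;> omega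

/-- The two problems differ only in the test `g` applied to profiles at the root. -/
theorem exists_decides {Q : ∀ n : ℕ, SimpleGraph (Fin n) → Prop} {g : Expr}
    {good : ℕ → ℕ → ℕ → Prop}
    (hg : ∀ {c n : ℕ} {R : CExpr c} (s : State), HasInput n R s → HasPowers n R (2 * c) s →
      (g.eval s ≠ 0 ↔ good n c (s.reg 4)))
    (hQ : ∀ {c n : ℕ} {R : CExpr c} {G : SimpleGraph (Fin n)}, R.Represents G →
      (Q n G ↔ ∃ γ < (n + 1) ^ (2 * c), CExpr.Feasible (n + 1) R γ 0 ∧ good n c γ)) :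
    ∃ p : Cmd, ∀ c A : ℕ, ∃ K : ℕ, ∀ (n : ℕ) (G : SimpleGraph (Fin n)) (T : CExpr c),
      T.Represents G → T.Irredundant → T.size ≤ A * n →
        Decides (K * Nat.size n) p (SatisfactoryPartition.inputCode G T) (K * n ^ (8 * c))
          (Q n G) := by
  -- The program is fixed before `c` and `A`. The first summand bounds the time and the constant
  -- part of the word length, the second the part that grows with `Nat.size n`.
  refine ⟨partitionCmd g, fun c A => ⟨boundConst c A * (partitionCmd g).weight +
    (8 * c) * (partitionCmd g).weight, fun n G T hG hT hA => ?_⟩⟩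
  set W := (partitionCmd g).weight with hW
  have hcard : Fintype.card T.Vert = n := by
    obtain ⟨φ⟩ := hG
    rw [Fintype.card_congr φ.toEquiv, Fintype.card_fin]
  have hn : 1 ≤ n := hcard ▸ Fintype.card_pos
  -- Some vertex exists, and its label is an element of `Fin c`.
  have hc : 1 ≤ c := by
    obtain ⟨v⟩ : Nonempty T.Vert := inferInstance
    exact (Nat.zero_le _).trans_lt (T.label v).2
  obtain ⟨hword, hrounds⟩ := wordBound_add_rounds_le hn hc hA
  have hsz : 1 ≤ Nat.size n := Nat.size_pos.2 hn
  have hfit : wordBound n T ^ W ≤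
      2 ^ ((boundConst c A * W + 8 * c * W) * Nat.size n) := by
    have hns : n ≤ 2 ^ Nat.size n := (Nat.lt_size_self n).le
    calc wordBound n T ^ W ≤ (2 ^ boundConst c A * (2 ^ Nat.size n) ^ (8 * c)) ^ W := by
          refine Nat.pow_le_pow_left (hword.trans ?_) _
          exact Nat.mul_le_mul Nat.lt_two_pow_self.le (Nat.pow_le_pow_left hns _)
      _ = 2 ^ (boundConst c A * W + 8 * c * W * Nat.size n) := by
          rw [← pow_mul, ← pow_add, ← pow_mul]; congr 1; ring
      _ ≤ _ := by
          refine Nat.pow_le_pow_right (by omega) ?_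
          rw [add_mul]
          exact Nat.add_le_add_right (Nat.le_mul_of_pos_right _ hsz) _
  obtain ⟨t, s, ht, hrun, hyes, hno⟩ := decides_partitionCmd hcard hT hfit G
    (good := good n c) (fun s hi hp => hg s hi hp)
  have hQ' := hQ hG
  refine ⟨t, s, ht.trans ?_, hrun, fun h => hyes (hQ'.1 h), fun h => hno fun h' => h (hQ'.2 h')⟩
  calc rounds n T * W ≤ boundConst c A * n ^ (8 * c) * W := Nat.mul_le_mul_right _ hrounds
    _ = boundConst c A * W * n ^ (8 * c) := by ring
    _ ≤ _ := Nat.mul_le_mul_right _ (Nat.le_add_right _ _)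

/-- The test whether both parts are nonempty. -/
def nonemptyE : Expr := reg 4 % basePowE cE * (reg 4 / basePowE cE)

/-- The test whether the parts have the same size. -/
def balancedE : Expr := eq (2 * (reg 4 % basePowE cE % nE)) nE

theorem eval_nonemptyE {s : State} (hi : HasInput n R s) (hp : HasPowers n R (2 * c) s) :
    nonemptyE.eval s ≠ 0 ↔ s.reg 4 % (n + 1) ^ c ≠ 0 ∧ s.reg 4 / (n + 1) ^ c ≠ 0 := by
  rw [nonemptyE, eval_mul, mul_ne_zero_iff, eval_mod, eval_div,
    hp.eval_basePow hi (by rw [hi.eval_c]; omega), hi.eval_c, eval_reg]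

theorem eval_balancedE {s : State} (hi : HasInput n R s) (hp : HasPowers n R (2 * c) s) :
    balancedE.eval s ≠ 0 ↔ 2 * (s.reg 4 % (n + 1) ^ c % n) = n := by
  rw [balancedE, eval_eq_ne_zero, eval_mul, eval_mod, eval_mod,
    hp.eval_basePow hi (by rw [hi.eval_c]; omega), hi.eval_c, hi.eval_n, eval_reg, eval_two]

end RAM

theorem theorem2 :
    (∃ p : RAM.Cmd, ∀ c A : ℕ, ∃ K : ℕ, ∀ (n : ℕ) (G : SimpleGraph (Fin n)) (T : CExpr c),
      T.Represents G → T.Irredundant → T.size ≤ A * n →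
        RAM.Decides (K * Nat.size n) p (SatisfactoryPartition.inputCode G T) (K * n ^ (8 * c))
          (SatisfactoryPartition.HasSatisfactoryPartition G)) ∧
    (∃ p : RAM.Cmd, ∀ c A : ℕ, ∃ K : ℕ, ∀ (n : ℕ) (G : SimpleGraph (Fin n)) (T : CExpr c),
      T.Represents G → T.Irredundant → T.size ≤ A * n →
        RAM.Decides (K * Nat.size n) p (SatisfactoryPartition.inputCode G T) (K * n ^ (8 * c))
          (SatisfactoryPartition.HasBalancedSatisfactoryPartition G)) :=
  ⟨RAM.exists_decides (Q := fun _ G => SatisfactoryPartition.HasSatisfactoryPartition G)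
    (good := fun n c γ => γ % (n + 1) ^ c ≠ 0 ∧ γ / (n + 1) ^ c ≠ 0)
    (fun _ hi hp => RAM.eval_nonemptyE hi hp) CExpr.hasSatisfactoryPartition_iff_feasible,
  RAM.exists_decides (Q := fun _ G => SatisfactoryPartition.HasBalancedSatisfactoryPartition G)
    (good := fun n c γ => 2 * (γ % (n + 1) ^ c % n) = n)
    (fun _ hi hp => RAM.eval_balancedE hi hp)
    CExpr.hasBalancedSatisfactoryPartition_iff_feasible⟩
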